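/- Let $\mathcal B_n$ be the family of all subsets of $[n]=\{1,\dots,n\}$ ordered by inclusion ($<$ is strict inclusion), with intervals $[X,Y]=\{Z: X\le Z\le Y\}$, $(X,Y)=\{Z:X<Z<Y\}$, and $(X,Y]$, $[X,Y)$ likewise. A coloring $c:\mathcal B_n\to[k]$ is exact if every color is used. A rainbow induced copy of $\mathcal B_2$ consists of four sets of pairwise distinct colors that form, under inclusion, a poset isomorphic to $\mathcal B_2$. A rainbow $t$-chain $(X_1,\dots,X_t)$ consists of $t$ sets $X_1<\dots<X_t$ of pairwise distinct colors. Families of sets are called *separated* if each is monochromatic and sets from different families have different colors. For $X<Y$ put $$U(X,Y)=\bigcup_{Z\in(X,Y)}[Z,[n]],\qquad D(X,Y)=\bigcup_{Z\in(X,Y)}[\emptyset,Z].$$ In Types 1, 2, 3-1, 3-2 there are sets $X_0,Y_0$ with $\emptyset<X_0<Y_0<[n]$ and $|Y_0|\ge|X_0|+2$ such that the following holds. * **Type 1**: $[\emptyset,Y_0]\setminus[X_0,Y_0]$, $\{X_0\}$, $(X_0,Y_0)$, $\{Y_0\}$, $[X_0,[n]]\setminus[X_0,Y_0]$ are separated,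 and each set outside $[\emptyset,Y_0]\cup[X_0,[n]]$ has the color of a set in the first or the last family. * **Type 2**: $[\emptyset,Y_0]\setminus[X_0,Y_0]$, $\{X_0,Y_0\}$, $(X_0,Y_0)$, $[X_0,[n]]\setminus[X_0,Y_0]$ are separated, and each set outside $[\emptyset,Y_0]\cup[X_0,[n]]$ has the color of a set in the first or the last family. * **Type 3-1**: $[\emptyset,Y_0]\setminus[X_0,Y_0]$, $\{X_0\}\cup(U(X_0,Y_0)\setminus(X_0,Y_0])$, $(X_0,Y_0)$, $\{Y_0\}$ are separated, and each set outside $[\emptyset,Y_0]\cup U(X_0,Y_0)$ has the color of a set in the first or the second family. * **Type 3-2**: $[X_0,[n]]\setminus[X_0,Y_0]$, $\{Y_0\}\cup(D(X_0,Y_0)\setminus[X_0,Y_0))$, $(X_0,Y_0)$, $\{X_0\}$ are separated, and each set outside $[X_0,[n]]\cup D(X_0,Y_0)$ has the color of a set in the first or the second family. The remaining types are as follows. * **Type 4-1**: there are a set $X_0$ with $1\le|X_0|\le n-2$ and a nonempty $\mathcal Y_0\subseteq(X_0,[n]]$ such that $\bigcup_{Y\in\mathcal Y_0}([\emptyset,Y)\setminus[X_0,Y))$,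 $\{X_0\}$, $(X_0,[n]]\setminus\mathcal Y_0$, $\mathcal Y_0$ are separated, and each set outside $[X_0,[n]]\cup\bigcup_{Y\in\mathcal Y_0}[\emptyset,Y)$ has the color of a set in the first or the third family. * **Type 4-2**: there are a set $Y_0$ with $2\le|Y_0|\le n-1$ and a nonempty $\mathcal X_0\subseteq(\emptyset,Y_0)$ such that $\bigcup_{X\in\mathcal X_0}((X,[n]]\setminus(X,Y_0])$, $\{Y_0\}$, $[\emptyset,Y_0)\setminus\mathcal X_0$, $\mathcal X_0$ are separated, and each set outside $[\emptyset,Y_0]\cup\bigcup_{X\in\mathcal X_0}(X,[n]]$ has the color of a set in the first or the third family. * **Type 5**: every rainbow chain has at most $4$ sets, and the following two conditions hold. 1. For every rainbow $4$-chain $(W,X,Y,[n])$ the families $(U(W,Y)\cup D(W,Y))\setminus[W,Y]$, $\{W\}$, $(W,Y)$, $\{Y\}$ are separated, each set in $[\emptyset,Y)\setminus D(W,Y)$ has the color of a set in the first or the last family, and each set in $(W,[n]]\setminus U(W,Y)$ has the color of a set in the first or the second family. 2. For every rainbow $3$-chain $(W,Y,[n])$ that cannot be extended to a rainbow $4$-chain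 by adding another set, exactly $3$ colors appear on $[\emptyset,Y]\cup[W,[n]]$. **Theorem.** Let $k\ge4$ and $n>4$ be integers and let $c$ be an exact $k$-coloring of $\mathcal B_n$. Then $\mathcal B_n$ contains no rainbow induced copy of $\mathcal B_2$ if and only if one of the following holds: 1. $c(\emptyset)\ne c([n])$ and $c$ is of Type 1, 2, 3-1, 3-2, 4-1 or 4-2; 2. $c(\emptyset)=c([n])$ and $c$ is of Type 5. Moreover, if $c$ is of Type 1, then $k=5$. -/

import Mathlib

namespace BooleanLattice

/-- The Boolean lattice of dimension `n`: all subsets of an `n`-element ground set, ordered by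
inclusion. Here `∅` is the bottom and `Finset.univ` is the full ground set `[n]`. -/
abbrev B (n : ℕ) : Type := Finset (Fin n)

variable {n k : ℕ}

/-- A `k`-coloring is exact if every one of the `k` colors is used. -/
def IsExact (c : B n → Fin k) : Prop := ∀ a : Fin k, ∃ X : B n, c X = a

/-- The coloring contains a rainbow induced copy of the poset `Q`: an order embedding of `Q`
(`f x ≤ f y ↔ x ≤ y`) whose image has pairwise distinct colors. -/
def HasRainbowInducedCopy (Q : Type) [PartialOrder Q] (c : B n → Fin k) : Prop :=
  ∃ f : Q ↪o B n, Function.Injective (fun q => c (f q))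

/-- A rainbow chain: pairwise comparable sets with pairwise distinct colors. -/
def IsRainbowChain (c : B n → Fin k) (C : Set (B n)) : Prop :=
  IsChain (· ≤ ·) C ∧ Set.InjOn c C

/-- Each of the families is monochromatic, and sets from different families get different
colors. -/
def DistinctMono (c : B n → Fin k) {m : ℕ} (F : Fin m → Set (B n)) : Prop :=
  (∀ i, ∀ X ∈ F i, ∀ Y ∈ F i, c X = c Y) ∧
    ∀ i j, i ≠ j → ∀ X ∈ F i, ∀ Y ∈ F j, c X ≠ c Y

/-- Every set of `R` has the same color as some set of `F` or of `G`. -/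
def ColoredLike (c : B n → Fin k) (R F G : Set (B n)) : Prop :=
  ∀ X ∈ R, ∃ Z ∈ F ∪ G, c X = c Z

/-- The union of the intervals `[Z, [n]]` over all `Z` with `X < Z < Y`. -/
def upFamily (X Y : B n) : Set (B n) :=
  ⋃ Z ∈ Set.Ioo X Y, Set.Icc Z Finset.univ

/-- The union of the intervals `[∅, Z]` over all `Z` with `X < Z < Y`. -/
def downFamily (X Y : B n) : Set (B n) :=
  ⋃ Z ∈ Set.Ioo X Y, Set.Icc ∅ Z

/-- Colorings of Type 1. -/
def IsType1 (c : B n → Fin k) : Prop :=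
  ∃ X₀ Y₀ : B n, ∅ < X₀ ∧ X₀ < Y₀ ∧ Y₀ < Finset.univ ∧ X₀.card + 2 ≤ Y₀.card ∧
    DistinctMono c
      ![Set.Icc ∅ Y₀ \ Set.Icc X₀ Y₀,
        {X₀},
        Set.Ioo X₀ Y₀,
        {Y₀},
        Set.Icc X₀ Finset.univ \ Set.Icc X₀ Y₀] ∧
    ColoredLike c (Set.univ \ (Set.Icc ∅ Y₀ ∪ Set.Icc X₀ Finset.univ))
      (Set.Icc ∅ Y₀ \ Set.Icc X₀ Y₀)
      (Set.Icc X₀ Finset.univ \ Set.Icc X₀ Y₀)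

/-- Colorings of Type 2. -/
def IsType2 (c : B n → Fin k) : Prop :=
  ∃ X₀ Y₀ : B n, ∅ < X₀ ∧ X₀ < Y₀ ∧ Y₀ < Finset.univ ∧ X₀.card + 2 ≤ Y₀.card ∧
    DistinctMono c
      ![Set.Icc ∅ Y₀ \ Set.Icc X₀ Y₀,
        {X₀, Y₀},
        Set.Ioo X₀ Y₀,
        Set.Icc X₀ Finset.univ \ Set.Icc X₀ Y₀] ∧
    ColoredLike c (Set.univ \ (Set.Icc ∅ Y₀ ∪ Set.Icc X₀ Finset.univ))
      (Set.Icc ∅ Y₀ \ Set.Icc X₀ Y₀)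
      (Set.Icc X₀ Finset.univ \ Set.Icc X₀ Y₀)

/-- Colorings of Type 3-1. -/
def IsType31 (c : B n → Fin k) : Prop :=
  ∃ X₀ Y₀ : B n, ∅ < X₀ ∧ X₀ < Y₀ ∧ Y₀ < Finset.univ ∧ X₀.card + 2 ≤ Y₀.card ∧
    DistinctMono c
      ![Set.Icc ∅ Y₀ \ Set.Icc X₀ Y₀,
        {X₀} ∪ (upFamily X₀ Y₀ \ Set.Ioc X₀ Y₀),
        Set.Ioo X₀ Y₀,
        {Y₀}] ∧
    ColoredLike c (Set.univ \ (Set.Icc ∅ Y₀ ∪ upFamily X₀ Y₀))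
      (Set.Icc ∅ Y₀ \ Set.Icc X₀ Y₀)
      ({X₀} ∪ (upFamily X₀ Y₀ \ Set.Ioc X₀ Y₀))

/-- Colorings of Type 3-2. -/
def IsType32 (c : B n → Fin k) : Prop :=
  ∃ X₀ Y₀ : B n, ∅ < X₀ ∧ X₀ < Y₀ ∧ Y₀ < Finset.univ ∧ X₀.card + 2 ≤ Y₀.card ∧
    DistinctMono c
      ![Set.Icc X₀ Finset.univ \ Set.Icc X₀ Y₀,
        {Y₀} ∪ (downFamily X₀ Y₀ \ Set.Ico X₀ Y₀),
        Set.Ioo X₀ Y₀,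
        {X₀}] ∧
    ColoredLike c (Set.univ \ (Set.Icc X₀ Finset.univ ∪ downFamily X₀ Y₀))
      (Set.Icc X₀ Finset.univ \ Set.Icc X₀ Y₀)
      ({Y₀} ∪ (downFamily X₀ Y₀ \ Set.Ico X₀ Y₀))

/-- Colorings of Type 4-1. -/
def IsType41 (c : B n → Fin k) : Prop :=
  ∃ (X₀ : B n) (𝒴 : Set (B n)), 1 ≤ X₀.card ∧ X₀.card + 2 ≤ n ∧
    𝒴 ⊆ Set.Ioc X₀ Finset.univ ∧ 𝒴.Nonempty ∧
    DistinctMono c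
      ![⋃ Y ∈ 𝒴, (Set.Ico ∅ Y \ Set.Ico X₀ Y),
        {X₀},
        Set.Ioc X₀ Finset.univ \ 𝒴,
        𝒴] ∧
    ColoredLike c (Set.univ \ (Set.Icc X₀ Finset.univ ∪ ⋃ Y ∈ 𝒴, Set.Ico ∅ Y))
      (⋃ Y ∈ 𝒴, (Set.Ico ∅ Y \ Set.Ico X₀ Y))
      (Set.Ioc X₀ Finset.univ \ 𝒴)

/-- Colorings of Type 4-2. -/
def IsType42 (c : B n → Fin k) : Prop :=
  ∃ (Y₀ : B n) (𝒳 : Set (B n)), 2 ≤ Y₀.card ∧ Y₀.card + 1 ≤ n ∧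
    𝒳 ⊆ Set.Ioo ∅ Y₀ ∧ 𝒳.Nonempty ∧
    DistinctMono c
      ![⋃ X ∈ 𝒳, (Set.Ioc X Finset.univ \ Set.Ioc X Y₀),
        {Y₀},
        Set.Ico ∅ Y₀ \ 𝒳,
        𝒳] ∧
    ColoredLike c (Set.univ \ (Set.Icc ∅ Y₀ ∪ ⋃ X ∈ 𝒳, Set.Ioc X Finset.univ))
      (⋃ X ∈ 𝒳, (Set.Ioc X Finset.univ \ Set.Ioc X Y₀))
      (Set.Ico ∅ Y₀ \ 𝒳)

/-- Colorings of Type 5: no rainbow chain has more than four sets; a block structure around every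
rainbow `4`-chain `(W, X, Y, [n])`; and exactly three colors on `[∅, Y] ∪ [W, [n]]` for every
rainbow `3`-chain `(W, Y, [n])` that is not contained in a rainbow `4`-chain. -/
def IsType5 (c : B n → Fin k) : Prop :=
  (∀ C : Set (B n), IsRainbowChain c C → C.ncard ≤ 4) ∧
  (∀ W X Y : B n, W < X → X < Y → Y < Finset.univ →
    IsRainbowChain c {W, X, Y, Finset.univ} →
      DistinctMono c
        ![(upFamily W Y ∪ downFamily W Y) \ Set.Icc W Y,
          {W},
          Set.Ioo W Y,
          {Y}] ∧
      ColoredLike c (Set.Ico ∅ Y \ downFamily W Y)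
        ((upFamily W Y ∪ downFamily W Y) \ Set.Icc W Y) {Y} ∧
      ColoredLike c (Set.Ioc W Finset.univ \ upFamily W Y)
        ((upFamily W Y ∪ downFamily W Y) \ Set.Icc W Y) {W}) ∧
  (∀ W Y : B n, W < Y → Y < Finset.univ →
    IsRainbowChain c {W, Y, Finset.univ} →
    (¬ ∃ Z : B n, Z ∉ ({W, Y, Finset.univ} : Set (B n)) ∧
      IsRainbowChain c {Z, W, Y, Finset.univ}) →
      (c '' (Set.Icc ∅ Y ∪ Set.Icc W Finset.univ)).ncard = 3)

end BooleanLattice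

/-!
A coloring is *rainbow-free* if no `A ≤ X, Y ≤ D` with `X`, `Y` incomparable have four distinct
colors. Almost everything below concerns rainbow-free colorings of an arbitrary Boolean algebra, so
that each argument can also be used in the order dual. The copies are built from relative
complements: `exists_incomparable` finds, in an interval, an element incomparable to prescribed
ones, and `interval_induction` deduces that a color which passes between incomparable elements of an
open interval fills it.

Suppose first that `c ⊥ ≠ c ⊤`, and call a set special if it has neither of these two colors. The
copies `⊥, X, Y, ⊤` show that special sets of different colors are comparable, and for special
`X < Y` of different colors the copies through `⊥` and `⊤` leave two possible colors for a set below
`Y` incomparable to `X` and for one above `X` incomparable to `Y` (`RainbowFree.color_below`,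
`RainbowFree.color_above`). As there are at least four colors, such a pair exists. There are three
possibilities.
* Some special chain `X < Y < V` has a middle color different from both outer ones. Then `(X, V)` is
  monochromatic, and the coloring is of Type 1 or 2 (`RainbowFree.isIntervalColoring`).
* Some `W` above a special pair `X < Y` of different colors has color `c ⊥`. Then `(X, W)` is
  monochromatic, and the coloring is of Type 3-2 (`RainbowFree.isLowerColoring`); dually one gets
  Type 3-1.
* Otherwise there are exactly two special colors, and the sets of one lie below those of the other
  (`IsTwoBlock`). One of these two blocks is a singleton (`IsTwoBlock.not_both_nontrivial`), and a
  closer look at the sets between them gives Type 4-1 or 4-2 (`IsTwoBlock.isSingletonColoring_or`).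

Conversely, in Types 1 to 3 all but two colors are confined to an interval in which incomparable
sets have equal colors, which excludes each position of a rainbow copy (`rainbowFree_of_core`);
Type 4 is similar (`rainbowFree_of_singleton`).

If `c ⊥ = c ⊤`, the same copies show that the open interval between the ends of a rainbow chain
`W < X < Y` avoiding this color is monochromatic (`RainbowFree.mid_of_chain`), which bounds the
length of rainbow chains and determines the coloring around `W` and `Y` (`RainbowFree.isBlock`). The
converse is `rainbowFree_of_blocks`.
-/

namespace BooleanLattice

/-! ### Rainbow-free colorings of an order -/

section Abstract

variable {α κ : Type*}

/-- The order-theoretic form of having no rainbow induced copy of `B 2`, for colorings of an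
arbitrary order. As the two middle elements are incomparable, the weak inequalities are strict. -/
def RainbowFree [LE α] (c : α → κ) : Prop :=
  ∀ A X Y D : α, A ≤ X → A ≤ Y → X ≤ D → Y ≤ D → ¬ X ≤ Y → ¬ Y ≤ X →
    c A = c X ∨ c A = c Y ∨ c A = c D ∨ c X = c Y ∨ c X = c D ∨ c Y = c D

theorem RainbowFree.dual [LE α] {c : α → κ} (h : RainbowFree c) :
    RainbowFree (fun x : αᵒᵈ => c (OrderDual.ofDual x)) := by
  intro A X Y D h1 h2 h3 h4 h5 h6
  have := h (OrderDual.ofDual D) (OrderDual.ofDual X) (OrderDual.ofDual Y) (OrderDual.ofDual A)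
    h3 h4 h1 h2 h6 h5
  grind

/-! ### Incomparable elements in an interval -/

section BooleanAlgebra

variable [BooleanAlgebra α]

/-- A relative complement `Z` of `P` in the interval `[T, V]` is incomparable to everything that
lies below `P` but not below `T`, and to everything that lies above `P` but not above `V`. -/
theorem exists_incomparable {T P V : α} (hTP : T < P) (hPV : P < V) :
    ∃ Z, T < Z ∧ Z < V ∧ (∀ Q, Q ≤ P → ¬ Q ≤ T → ¬ Q ≤ Z ∧ ¬ Z ≤ Q) ∧
      (∀ Q, P ≤ Q → ¬ V ≤ Q → ¬ Q ≤ Z ∧ ¬ Z ≤ Q) := by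
  have hinf : P ⊓ (T ⊔ V \ P) = T := by
    rw [inf_sup_left, inf_sdiff_self_right, sup_bot_eq]
    exact inf_eq_right.2 hTP.le
  have hsup : P ⊔ (T ⊔ V \ P) = V := by
    rw [sup_left_comm, sup_sdiff_self_right, sup_eq_right.2 hPV.le,
      sup_eq_right.2 (hTP.trans hPV).le]
  generalize T ⊔ V \ P = Z at hinf hsup
  have hT : T ≤ Z := hinf ▸ inf_le_right
  have hV : Z ≤ V := hsup ▸ le_sup_right
  have h1 : ¬ Z ≤ P := fun h => hPV.not_ge (hsup ▸ sup_le le_rfl h)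
  have h2 : ¬ P ≤ Z := fun h => hTP.not_ge (hinf ▸ le_inf le_rfl h)
  refine ⟨Z, hT.lt_of_not_ge fun h => h1 (h.trans hTP.le),
    hV.lt_of_not_ge fun h => h2 (hPV.le.trans h), fun Q hQ hQT => ⟨fun h => hQT ?_, fun h => ?_⟩,
    fun Q hQ hQV => ⟨fun h => h2 (hQ.trans h), fun h => hQV ?_⟩⟩
  · exact hinf ▸ le_inf hQ h
  · exact h1 (h.trans hQ)
  · exact hsup ▸ sup_le hQ h

/-- A property that passes between incomparable elements of an open interval of a Boolean algebra
holds on all of the interval once it holds somewhere: two comparable elements of the interval are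
both incomparable to a third one. -/
theorem interval_induction {X V : α} {p : α → Prop}
    (hp : ∀ Y Z, X < Y → Y < V → X < Z → Z < V → ¬ Y ≤ Z → ¬ Z ≤ Y → p Y → p Z)
    {Y : α} (hXY : X < Y) (hYV : Y < V) (hY : p Y) : ∀ Z, X < Z → Z < V → p Z := by
  intro Z hXZ hZV
  have key : ∀ P, X < P → P < V → Y ≤ P → Z ≤ P → p Z := by
    intro P hXP hPV hYP hZP
    obtain ⟨R, hXR, hRV, hR, -⟩ := exists_incomparable hXP hPV
    have h1 := hR Y hYP hXY.not_ge
    have h2 := hR Z hZP hXZ.not_ge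
    exact hp R Z hXR hRV hXZ hZV h2.2 h2.1 (hp Y R hXY hYV hXR hRV h1.1 h1.2 hY)
  by_cases h1 : Y ≤ Z
  · exact key Z hXZ hZV h1 le_rfl
  by_cases h2 : Z ≤ Y
  · exact key Y hXY hYV le_rfl h2
  exact hp Y Z hXY hYV hXZ hZV h1 h2 hY

/-- An element that is neither above nor below `X` and lies below `V` is incomparable to some
element strictly between `X` and `V`. -/
theorem exists_between_incomparable {X Y V T : α} (hXY : X < Y) (hYV : Y < V) (hTV : T ≤ V)
    (h1 : ¬ X ≤ T) (h2 : ¬ T ≤ X) : ∃ Z, X < Z ∧ Z < V ∧ ¬ Z ≤ T ∧ ¬ T ≤ Z := by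
  by_cases h : V ≤ X ⊔ T
  · exact ⟨Y, hXY, hYV, fun h' => h1 (hXY.le.trans h'),
      fun h' => hYV.not_ge (h.trans (sup_le hXY.le h'))⟩
  · have hlt : X ⊔ T < V := (sup_le (hXY.trans hYV).le hTV).lt_of_not_ge h
    obtain ⟨Z, hXZ, hZV, hZ, -⟩ := exists_incomparable (left_lt_sup.2 h2) hlt
    have := hZ T le_sup_right h2
    exact ⟨Z, hXZ, hZV, this.2, this.1⟩

theorem exists_between_not_le {X Y V T : α} (hXY : X < Y) (hYV : Y < V) (hVT : ¬ V ≤ T) :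
    ∃ Z, X < Z ∧ Z < V ∧ ¬ Z ≤ T := by
  by_cases h : Y ≤ T
  · obtain ⟨Z, hXZ, hZV, -, hZ⟩ := exists_incomparable (hXY.trans_le (le_inf hYV.le h))
      (inf_lt_left.2 hVT)
    exact ⟨Z, hXZ, hZV, (hZ T inf_le_right hVT).2⟩
  · exact ⟨Y, hXY, hYV, h⟩

end BooleanAlgebra

/-! ### Special sets -/

section Colors

variable [BooleanAlgebra α] {c : α → κ}

/-- `X` is special when its color is neither that of the bottom nor that of the top element. -/
def Special (c : α → κ) (X : α) : Prop := c X ≠ c ⊥ ∧ c X ≠ c ⊤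

/-- Otherwise `⊥, X, Y, ⊤` would be a rainbow copy. -/
theorem RainbowFree.special_comparable (h : RainbowFree c) (h01 : c ⊥ ≠ c ⊤) {X Y : α}
    (hX : Special c X) (hY : Special c Y) (hXY : c X ≠ c Y) : X < Y ∨ Y < X := by
  have := h ⊥ X Y ⊤ bot_le bot_le le_top le_top
  have hne : X ≠ Y := fun h => hXY (h ▸ rfl)
  rw [lt_iff_le_and_ne, lt_iff_le_and_ne]
  unfold Special at *
  grind

theorem RainbowFree.color_of_incomparable (h : RainbowFree c) (h01 : c ⊥ ≠ c ⊤) {X Z : α}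
    (hX : Special c X) (h1 : ¬ X ≤ Z) (h2 : ¬ Z ≤ X) : c Z = c ⊥ ∨ c Z = c ⊤ ∨ c Z = c X := by
  have := h ⊥ X Z ⊤ bot_le bot_le le_top le_top h1 h2
  unfold Special at *
  grind

theorem RainbowFree.color_below (h : RainbowFree c) (h01 : c ⊥ ≠ c ⊤) {X Y Z : α}
    (hX : Special c X) (hY : Special c Y) (hne : c X ≠ c Y) (hXY : X < Y) (hZ : Z ≤ Y)
    (h1 : ¬ X ≤ Z) (h2 : ¬ Z ≤ X) : c Z = c ⊥ ∨ c Z = c X := by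
  have a := h.color_of_incomparable h01 hX h1 h2
  have b := h ⊥ X Z Y bot_le bot_le hXY.le hZ h1 h2
  unfold Special at *
  grind

theorem RainbowFree.color_above (h : RainbowFree c) (h01 : c ⊥ ≠ c ⊤) {X Y Z : α}
    (hX : Special c X) (hY : Special c Y) (hne : c X ≠ c Y) (hXY : X < Y) (hZ : X ≤ Z)
    (h1 : ¬ Y ≤ Z) (h2 : ¬ Z ≤ Y) : c Z = c ⊤ ∨ c Z = c Y :=
  h.dual.color_below h01.symm ⟨hY.2, hY.1⟩ ⟨hX.2, hX.1⟩ hne.symm hXY hZ h2 h1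

/-- If the outer two of three special sets in a chain differ in color from the middle one, then
the whole open interval between them has the color of the middle one. -/
theorem RainbowFree.interval_color (h : RainbowFree c) (h01 : c ⊥ ≠ c ⊤) {X Y V : α}
    (hX : Special c X) (hY : Special c Y) (hV : Special c V) (hXY : X < Y) (hYV : Y < V)
    (h1 : c X ≠ c Y) (h2 : c Y ≠ c V) : ∀ Z, X < Z → Z < V → c Z = c Y := by
  refine interval_induction (p := fun Z => c Z = c Y) ?_ hXY hYV rfl
  intro P Q hXP hPV hXQ hQV hPQ hQP hP
  have hPs : Special c P := by unfold Special at *; rwa [hP]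
  have a := h.color_above h01 hX hPs (hP ▸ h1) hXP hXQ.le hPQ hQP
  have b := h.color_below h01 hPs hV (hP ▸ h2) hPV hQV.le hPQ hQP
  grind

end Colors
end Abstract

/-! ### Special chains whose middle color differs from the outer ones -/

section Abstract

variable {α κ : Type*} [BooleanAlgebra α] {c : α → κ}

/-- For a special chain `X < Y < V` as in `RainbowFree.interval_color`, every element of `[⊥, V]`
that is not above `X` has the color of the bottom. -/
theorem RainbowFree.color_of_le_of_not_ge (h : RainbowFree c) (h01 : c ⊥ ≠ c ⊤) {X Y V : α}
    (hX : Special c X) (hY : Special c Y) (hV : Special c V) (hXY : X < Y) (hYV : Y < V)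
    (h1 : c X ≠ c Y) (h2 : c Y ≠ c V) (T : α) (hTV : T ≤ V) (hT : ¬ X ≤ T) : c T = c ⊥ := by
  have hmid := h.interval_color h01 hX hY hV hXY hYV h1 h2
  have hinc : ∀ T, T ≤ V → ¬ X ≤ T → ¬ T ≤ X → c T = c ⊥ := by
    intro T hTV hT hTX
    obtain ⟨Z, hXZ, hZV, hZT, hTZ⟩ := exists_between_incomparable hXY hYV hTV hT hTX
    have hcZ := hmid Z hXZ hZV
    have hZ : Special c Z := by unfold Special at *; rwa [hcZ]
    have a := h.color_below h01 hZ hV (hcZ ▸ h2) hZV hTV hZT hTZ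
    have b := h.color_of_incomparable h01 hX hT hTX
    unfold Special at *
    grind
  by_cases hTX : T ≤ X
  -- For `T < X`, some `R > T` incomparable to `X` already has the color of the bottom, and serves
  -- as a middle element of copies that start at `T`.
  · have hlt : T < X := hTX.lt_of_not_ge hT
    obtain ⟨R, hTR, hRY, hR, -⟩ := exists_incomparable hlt hXY
    have hRX := hR X le_rfl hT
    have hcR := hinc R (hRY.trans hYV).le hRX.1 hRX.2
    by_contra hT0
    by_cases hT1 : c T = c ⊤
    · obtain ⟨Z, hXZ, hZV, hZ, -⟩ := exists_incomparable hXY hYV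
      have hRZ := hZ R hRY.le hRX.2
      have hcZ := hmid Z hXZ hZV
      have := h T R Z V hTR.le (hlt.trans hXZ).le (hRY.trans hYV).le hZV.le hRZ.1 hRZ.2
      unfold Special at *
      grind
    · have hTs : Special c T := ⟨hT0, hT1⟩
      by_cases hcT : c T = c X
      · have := h.interval_color h01 hTs hY hV (hlt.trans hXY) hYV (hcT ▸ h1) h2 X hlt
          (hXY.trans hYV)
        exact h1 this
      · have := h.interval_color h01 hTs hX hY hlt hXY hcT h1 R hTR hRY
        exact hX.1 (this.symm.trans hcR)
  · exact hinc T hTV hT hTX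

/-- The colorings of Types 1 and 2, pointwise and over any Boolean algebra: `X` and `V` are the
ends of the interval, `b` is the color of its interior, and the type is 1 or 2 according to whether
`c X ≠ c V` or `c X = c V`. The definition is self-dual. -/
structure IsIntervalColoring (c : α → κ) (X V : α) (b : κ) : Prop where
  ne : c ⊥ ≠ c ⊤
  left : Special c X
  right : Special c V
  mid_ne : b ≠ c ⊥ ∧ b ≠ c ⊤ ∧ b ≠ c X ∧ b ≠ c V
  exists_mid : ∃ Y, X < Y ∧ Y < V
  mid : ∀ Z, X < Z → Z < V → c Z = b
  below : ∀ Z, Z ≤ V → ¬ X ≤ Z → c Z = c ⊥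
  above : ∀ Z, X ≤ Z → ¬ Z ≤ V → c Z = c ⊤
  outside : ∀ Z, ¬ X ≤ Z → ¬ Z ≤ V → c Z = c ⊥ ∨ c Z = c ⊤

theorem RainbowFree.isIntervalColoring (h : RainbowFree c) (h01 : c ⊥ ≠ c ⊤) {X Y V : α}
    (hX : Special c X) (hY : Special c Y) (hV : Special c V) (hXY : X < Y) (hYV : Y < V)
    (h1 : c X ≠ c Y) (h2 : c Y ≠ c V) : IsIntervalColoring c X V (c Y) where
  ne := h01
  left := hX
  right := hV
  mid_ne := ⟨hY.1, hY.2, h1.symm, h2⟩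
  exists_mid := ⟨Y, hXY, hYV⟩
  mid := h.interval_color h01 hX hY hV hXY hYV h1 h2
  below := h.color_of_le_of_not_ge h01 hX hY hV hXY hYV h1 h2
  above Z hXZ hZV := h.dual.color_of_le_of_not_ge (X := OrderDual.toDual V)
    (Y := OrderDual.toDual Y) (V := OrderDual.toDual X) h01.symm ⟨hV.2, hV.1⟩ ⟨hY.2, hY.1⟩
    ⟨hX.2, hX.1⟩ hYV hXY h2.symm
    h1.symm (OrderDual.toDual Z) hXZ hZV
  outside Z hXZ hZV := by
    have a := h.color_of_incomparable h01 hX hXZ fun h => hZV (h.trans (hXY.trans hYV).le)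
    have b := h.color_of_incomparable h01 hY (fun h => hXZ (hXY.le.trans h))
      fun h => hZV (h.trans hYV.le)
    grind

/-! ### A set above a special pair that has the color of the bottom -/

/-- The colorings of Type 3-2, pointwise and over any Boolean algebra: `X` and `W` are the ends of
the interval and `b` is the color of its interior. Those of Type 3-1 are the dual ones. -/
structure IsLowerColoring (c : α → κ) (X W : α) (b : κ) : Prop where
  ne : c ⊥ ≠ c ⊤
  left : Special c X
  mid_ne : b ≠ c ⊥ ∧ b ≠ c ⊤ ∧ b ≠ c X
  exists_mid : ∃ Y, X < Y ∧ Y < W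
  mid : ∀ Z, X < Z → Z < W → c Z = b
  right : c W = c ⊥
  above : ∀ Z, X ≤ Z → ¬ Z ≤ W → c Z = c ⊤
  below : ∀ Y, X < Y → Y < W → ∀ Z, Z ≤ Y → ¬ X ≤ Z → c Z = c ⊥
  outside : ∀ Z, ¬ X ≤ Z → c Z = c ⊥ ∨ c Z = c ⊤

/-- If some `W` above a special pair `X < Y` of different colors has the color of the bottom, then
`(X, W)` is monochromatic and the whole coloring is determined up to the sets not above `X`. -/
theorem RainbowFree.isLowerColoring (h : RainbowFree c) (h01 : c ⊥ ≠ c ⊤) {X Y W : α}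
    (hX : Special c X) (hY : Special c Y) (hW : c W = c ⊥) (hXY : X < Y) (hYW : Y < W)
    (h1 : c X ≠ c Y) : IsLowerColoring c X W (c Y) := by
  have hmid : ∀ Z, X < Z → Z < W → c Z = c Y := by
    refine interval_induction (p := fun Z => c Z = c Y) ?_ hXY hYW rfl
    intro P Q hXP hPW hXQ hQW hPQ hQP hP
    have hPs : Special c P := by unfold Special at *; rwa [hP]
    have a := h.color_above h01 hX hPs (hP ▸ h1) hXP hXQ.le hPQ hQP
    have b := h X P Q W hXP.le hXQ.le hPW.le hQW.le hPQ hQP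
    unfold Special at *
    grind
  have hmids : ∀ Z, X < Z → Z < W → Special c Z := fun Z h1 h2 => by
    unfold Special at *; rwa [hmid Z h1 h2]
  have hinc : ∀ Z, X < Z → ¬ Z ≤ W → ¬ W ≤ Z → c Z = c ⊤ := by
    intro Z hXZ hZW hWZ
    obtain ⟨P, hXP, hPW, hPZ⟩ := exists_between_not_le hXY hYW hWZ
    have hcP := hmid P hXP hPW
    have a := h.color_above h01 hX (hmids P hXP hPW) (hcP ▸ h1) hXP hXZ.le hPZ
      fun h => hZW (h.trans hPW.le)
    have b := h X Z W ⊤ hXZ.le (hXY.trans hYW).le le_top le_top hZW hWZ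
    unfold Special at *
    grind
  have hbinc : ∀ P, X < P → P < W → ∀ Z, Z ≤ P → ¬ X ≤ Z → ¬ Z ≤ X → c Z = c ⊥ := by
    intro P hXP hPW Z hZP hXZ hZX
    have hcP := hmid P hXP hPW
    have a := h.color_below h01 hX (hmids P hXP hPW) (hcP ▸ h1) hXP hZP hXZ hZX
    obtain ⟨R, hXR, hRW, hR, -⟩ := exists_incomparable hXP hPW
    have hZR := hR Z hZP hZX
    have hcR := hmid R hXR hRW
    have b := h.color_of_incomparable h01 (hmids R hXR hRW) hZR.2 hZR.1
    unfold Special at *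
    grind
  have hbelow : ∀ P, X < P → P < W → ∀ Z, Z ≤ P → ¬ X ≤ Z → c Z = c ⊥ := by
    intro P hXP hPW Z hZP hXZ
    by_cases hZX : Z ≤ X
    · have hlt : Z < X := hZX.lt_of_not_ge hXZ
      obtain ⟨R, hZR, hRP, hR, -⟩ := exists_incomparable hlt hXP
      have hRX := hR X le_rfl hXZ
      have hcR := hbinc P hXP hPW R hRP.le hRX.1 hRX.2
      obtain ⟨S, hXS, hSW, hS, -⟩ := exists_incomparable hXP hPW
      have hRS := hS R hRP.le hRX.2
      have hcS := hmid S hXS hSW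
      have hcP := hmid P hXP hPW
      have a := h Z R X P hZR.le hlt.le hRP.le hXP.le hRX.2 hRX.1
      have b := h Z R X ⊤ hZR.le hlt.le le_top le_top hRX.2 hRX.1
      have d := h Z R S ⊤ hZR.le (hlt.trans hXS).le le_top le_top hRS.1 hRS.2
      unfold Special at *
      grind
    · exact hbinc P hXP hPW Z hZP hXZ hZX
  refine ⟨h01, hX, ⟨hY.1, hY.2, h1.symm⟩, ⟨Y, hXY, hYW⟩, hmid, hW, ?_, hbelow, ?_⟩
  · intro Z hXZ hZW
    by_cases hWZ : W ≤ Z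
    · have hlt : W < Z := hWZ.lt_of_not_ge hZW
      have hYZ := hYW.trans hlt
      by_contra hZ1
      obtain ⟨R, hYR, hRZ, -, hR⟩ := exists_incomparable hYW hlt
      have hRW := hR W le_rfl hlt.not_ge
      have hcR := hinc R (hXY.trans hYR) hRW.2 hRW.1
      obtain ⟨S, hXS, hSW, hS⟩ := exists_between_not_le hXY hYW hRW.1
      have hcS := hmid S hXS hSW
      have a := h Y R W Z hYR.le hYW.le hRZ.le hlt.le hRW.2 hRW.1
      have b := h X R W Z (hXY.trans hYR).le (hXY.trans hYW).le hRZ.le hlt.le hRW.2 hRW.1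
      have d := h X R S Z (hXY.trans hYR).le hXS.le hRZ.le (hSW.trans hlt).le
        (fun h => hRW.2 (h.trans hSW.le)) hS
      unfold Special at *
      grind
    · exact hinc Z (hXZ.lt_of_not_ge fun h => hZW (h.trans (hXY.trans hYW).le)) hZW hWZ
  · intro Z hXZ
    by_cases hZY : Z ≤ Y
    · exact Or.inl (hbelow Y hXY hYW Z hZY hXZ)
    · have a := h.color_of_incomparable h01 hY (fun h => hXZ (hXY.le.trans h)) hZY
      have b := h.color_of_incomparable h01 hX hXZ fun h => hZY (h.trans hXY.le)
      grind

end Abstract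

/-! ### Two monochromatic blocks of special sets -/

section Abstract

variable {α κ : Type*} [BooleanAlgebra α] {c : α → κ}

/-- The colorings of Type 4-1, pointwise and over any Boolean algebra: `X` is the singleton and `b`
is the color of the special family above it. Those of Type 4-2 are the dual ones. -/
structure IsSingletonColoring (c : α → κ) (X : α) (b : κ) : Prop where
  ne : c ⊥ ≠ c ⊤
  left : Special c X
  top_ne : b ≠ c ⊥ ∧ b ≠ c ⊤ ∧ b ≠ c X
  exists_top : ∃ Y, X < Y ∧ c Y = b
  above : ∀ Z, X < Z → c Z = b ∨ c Z = c ⊤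
  below : ∀ Y, X < Y → c Y = b → ∀ Z, Z ≤ Y → ¬ X ≤ Z → c Z = c ⊥
  outside : ∀ Z, ¬ X ≤ Z → c Z = c ⊥ ∨ c Z = c ⊤

/-- What remains when no special chain has a middle color different from both outer ones and no
set outside the special ones triggers `RainbowFree.isLowerColoring` or its dual: the only special
colors are `a` and `b`, every element of color `a` is below every element of color `b`, nothing
above the upper block has the color of the bottom, and nothing below the lower block has the color
of the top. -/
structure IsTwoBlock (c : α → κ) (a b : κ) : Prop where
  free : RainbowFree c
  ne : c ⊥ ≠ c ⊤
  ab : a ≠ b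
  left : a ≠ c ⊥ ∧ a ≠ c ⊤
  right : b ≠ c ⊥ ∧ b ≠ c ⊤
  special : ∀ Z, Special c Z → c Z = a ∨ c Z = b
  lt : ∀ X Y, c X = a → c Y = b → X < Y
  above : ∀ Y Z, c Y = b → Y < Z → c Z ≠ c ⊥
  below : ∀ X Z, c X = a → Z < X → c Z ≠ c ⊤

namespace IsTwoBlock

variable {a b : κ}

theorem dual (h : IsTwoBlock c a b) :
    IsTwoBlock (fun x : αᵒᵈ => c (OrderDual.ofDual x)) b a where
  free := h.free.dual
  ne := h.ne.symm
  ab := h.ab.symm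
  left := ⟨h.right.2, h.right.1⟩
  right := ⟨h.left.2, h.left.1⟩
  special Z hZ := (h.special Z ⟨hZ.2, hZ.1⟩).symm
  lt X Y hX hY := h.lt Y X hY hX
  above := h.below
  below := h.above

theorem special_left (h : IsTwoBlock c a b) {X : α} (hX : c X = a) : Special c X := by
  have := h.left; unfold Special; rwa [hX]

theorem special_right (h : IsTwoBlock c a b) {X : α} (hX : c X = b) : Special c X := by
  have := h.right; unfold Special; rwa [hX]

/-- One of the two blocks is a singleton: given two elements in each of them, there is a set between
`X` and `Y`, incomparable to `J` and `K`, for which `color_above` and `color_below` leave no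
color. -/
theorem not_both_nontrivial (h : IsTwoBlock c a b) {X J K Y : α} (hX : c X = a) (hJ : c J = a)
    (hK : c K = b) (hY : c Y = b) (hJX : J ≠ X) (hYK : Y ≠ K) : False := by
  wlog hJX' : ¬ J ≤ X generalizing X J
  · exact this hJ hX hJX.symm fun h' => hJX (le_antisymm (not_not.1 hJX') h')
  wlog hYK' : ¬ Y ≤ K generalizing K Y
  · exact this hY hK hYK.symm fun h' => hYK (le_antisymm (not_not.1 hYK') h')
  have hlt : X < K ⊓ Y := (le_inf (h.lt X K hX hK).le (h.lt X Y hX hY).le).lt_of_not_ge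
    fun h' => hJX' ((le_inf (h.lt J K hJ hK).le (h.lt J Y hJ hY).le).trans h')
  obtain ⟨Q, hXQ, hQY, h1, h2⟩ := exists_incomparable hlt (inf_lt_right.2 hYK')
  have hJQ := h1 J (le_inf (h.lt J K hJ hK).le (h.lt J Y hJ hY).le) hJX'
  have hKQ := h2 K inf_le_left hYK'
  have hab := h.ab
  have e1 := h.free.color_above h.ne (h.special_left hX) (h.special_right hK) (by grind)
    (h.lt X K hX hK) hXQ.le hKQ.1 hKQ.2
  have e2 := h.free.color_below h.ne (h.special_left hJ) (h.special_right hY) (by grind)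
    (h.lt J Y hJ hY) hQY.le hJQ.1 hJQ.2
  have := h.left
  have := h.right
  have := h.ne
  grind

/-- If some set above an element of the lower block has the color of the bottom, then the upper
block is a singleton. -/
theorem eq_of_color_bot (h : IsTwoBlock c a b) {X Z Y Y' : α} (hX : c X = a) (hXZ : X < Z)
    (hZ : c Z = c ⊥) (hY : c Y = b) (hY' : c Y' = b) : Y' = Y := by
  have hab := h.ab
  have hr := h.right
  have hl := h.left
  have hne := h.ne
  have hZY : ∀ Y, c Y = b → Z ≤ Y := by
    intro Y hY
    by_contra hZY
    by_cases hYZ : Y ≤ Z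
    · exact h.above Y Z hY (hYZ.lt_of_not_ge hZY) hZ
    · have := h.free.color_above h.ne (h.special_left hX) (h.special_right hY) (by grind)
        (h.lt X Y hX hY) hXZ.le hYZ hZY
      grind
  by_contra hYY
  wlog hle : ¬ Y' ≤ Y generalizing Y Y'
  · exact this hY' hY (Ne.symm hYY) fun h' => hYY (le_antisymm (not_not.1 hle) h')
  obtain ⟨Q, hXQ, hQY, h1, h2⟩ := exists_incomparable
    (hXZ.trans_le (le_inf (hZY Y hY) (hZY Y' hY'))) (inf_lt_right.2 hle)
  have hZQ := h1 Z (le_inf (hZY Y hY) (hZY Y' hY')) hXZ.not_ge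
  have hYQ := h2 Y inf_le_left hle
  have e1 := h.free.color_above h.ne (h.special_left hX) (h.special_right hY) (by grind)
    (h.lt X Y hX hY) hXQ.le hYQ.1 hYQ.2
  have e2 := h.free X Z Q Y' hXZ.le hXQ.le (hZY Y' hY') hQY.le hZQ.1 hZQ.2
  have e3 : c Q ≠ b := fun hQ => hZQ.1 (hZY Q hQ)
  grind

theorem isSingletonColoring (h : IsTwoBlock c a b) {X Y : α} (hX : c X = a) (hY : c Y = b)
    (hX1 : ∀ X', c X' = a → X' = X) (h0 : ∀ Z, X < Z → c Z ≠ c ⊥) :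
    IsSingletonColoring c X b where
  ne := h.ne
  left := h.special_left hX
  top_ne := ⟨h.right.1, h.right.2, fun h' => h.ab (by rw [h', hX])⟩
  exists_top := ⟨Y, h.lt X Y hX hY, hY⟩
  above Z hZ := by
    have h1 := h0 Z hZ
    have h2 := hX1 Z
    have h3 := h.special Z
    have h4 := hZ.ne'
    unfold Special at *
    grind
  below Y hXY hY Z hZY hXZ := by
    by_cases hZX : Z ≤ X
    · have hlt := hZX.lt_of_not_ge hXZ
      have h1 := h.below X Z hX hlt
      have h2 := hX1 Z
      have h3 := h.special Z
      have h4 := hlt.ne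
      have h5 := h.lt X Z hX
      have h6 := hlt.not_gt
      unfold Special at *
      grind
    · have h1 := h.free.color_below h.ne (h.special_left hX) (h.special_right hY)
        (fun h' => h.ab (by rw [← hX, h', hY])) hXY hZY hXZ hZX
      have h2 := hX1 Z
      have h3 : Z ≠ X := fun h' => hZX h'.le
      grind
  outside Z hXZ := by
    have h2 := hX1 Z
    have h3 := h.special Z
    have h4 : Z ≠ X := fun h' => hXZ h'.ge
    have h5 : c Z ≠ b := fun h' => hXZ (h.lt X Z hX h').le
    unfold Special at *
    grind

theorem isSingletonColoring_or (h : IsTwoBlock c a b) {X Y : α} (hX : c X = a) (hY : c Y = b) :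
    IsSingletonColoring c X b ∨
      IsSingletonColoring (fun x : αᵒᵈ => c (OrderDual.ofDual x)) (OrderDual.toDual Y) a := by
  by_cases hX1 : ∀ X', c X' = a → X' = X
  · by_cases h0 : ∀ Z, X < Z → c Z ≠ c ⊥
    · exact Or.inl (h.isSingletonColoring hX hY hX1 h0)
    · right
      push Not at h0
      obtain ⟨Z, hXZ, hZ⟩ := h0
      have hY1 : ∀ Y', c Y' = b → Y' = Y := fun Y' hY' => h.eq_of_color_bot hX hXZ hZ hY hY'
      have hl := h.left
      have hr := h.right
      have hn := h.ne
      have hZY : Z < Y := by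
        have hYZ : ¬ Y ≤ Z := fun h' => h.above Y Z hY
          (h'.lt_of_ne fun h'' => hr.1 (by rw [← hY, h'', hZ])) hZ
        refine lt_of_le_not_ge ?_ hYZ
        by_contra hZY
        have := h.free.color_above h.ne (h.special_left hX) (h.special_right hY)
          (fun h' => h.ab (by rw [← hX, h', hY])) (h.lt X Y hX hY) hXZ.le hYZ hZY
        grind
      -- Between the two singletons only the colors of bottom and top occur, and incomparable
      -- sets have the same color, so the whole interval has the color of `Z`.
      have hmid := interval_induction (X := X) (V := Y) (p := fun Z => c Z = c ⊥) (by
        intro P Q hXP hPY hXQ hQY hPQ hQP hP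
        have e1 := h.free X P Q Y hXP.le hXQ.le hPY.le hQY.le hPQ hQP
        have e2 := h.special Q
        have e3 := hX1 Q
        have e4 := hXQ.ne'
        have e5 := hY1 Q
        have e6 := hQY.ne
        have e7 := h.ab
        unfold Special at *
        grind) hXZ hZY hZ
      have hbelow : ∀ Q, Q < Y → c Q ≠ c ⊤ := by
        intro Q hQY hQ
        by_cases hXQ : X < Q
        · exact hn ((hmid Q hXQ hQY).symm.trans hQ)
        · have hXQ' : ¬ X ≤ Q := fun h' => hXQ (h'.lt_of_ne fun h'' => hl.2 (by rw [← hX, h'', hQ]))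
          have hQX : ¬ Q ≤ X := fun h' => h.below X Q hX (h'.lt_of_not_ge hXQ') hQ
          have := h.free.color_below h.ne (h.special_left hX) (h.special_right hY)
            (fun h' => h.ab (by rw [← hX, h', hY])) (h.lt X Y hX hY) hQY.le hXQ' hQX
          grind
      refine h.dual.isSingletonColoring (X := OrderDual.toDual Y) hY hX hY1 ?_
      intro Z₁ hZY (hZ₁ : c (OrderDual.ofDual Z₁) = c ⊤)
      exact hbelow (OrderDual.ofDual Z₁) hZY hZ₁
  · right
    push Not at hX1
    obtain ⟨X', hX', hne⟩ := hX1
    have hY1 : ∀ Y', c Y' = b → Y' = Y := fun Y' hY' => by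
      by_contra hYY
      exact h.not_both_nontrivial hX hX' hY hY' hne hYY
    refine h.dual.isSingletonColoring (X := OrderDual.toDual Y) hY hX hY1 fun Z hZY hZ => ?_
    exact hne (h.dual.eq_of_color_bot (X := OrderDual.toDual Y) hY hZY hZ hX hX')

end IsTwoBlock

/-- The classification for different bottom and top colors and at least two special colors. -/
theorem RainbowFree.classification (h : RainbowFree c) (h01 : c ⊥ ≠ c ⊤) {X Y : α}
    (hX : Special c X) (hY : Special c Y) (hXY : c X ≠ c Y) :
    (∃ X V b, IsIntervalColoring c X V b) ∨
    (∃ X W b, IsLowerColoring c X W b) ∨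
    (∃ X W b, IsLowerColoring (fun x : αᵒᵈ => c (OrderDual.ofDual x)) X W b) ∨
    (∃ X b, IsSingletonColoring c X b) ∨
    (∃ X b, IsSingletonColoring (fun x : αᵒᵈ => c (OrderDual.ofDual x)) X b) := by
  by_contra! hcon
  obtain ⟨hI, hL, hL', hS, hS'⟩ := hcon
  wlog hlt : X < Y generalizing X Y
  · exact this hY hX hXY.symm ((h.special_comparable h01 hX hY hXY).resolve_left hlt)
  have hno : ∀ P Q R, Special c P → Special c Q → Special c R → P < Q → Q < R → c P ≠ c Q →
      c Q ≠ c R → False := fun P Q R hP hQ hR hPQ hQR h1 h2 =>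
    hI _ _ _ (h.isIntervalColoring h01 hP hQ hR hPQ hQR h1 h2)
  have hab : ∀ Z, Special c Z → c Z = c X ∨ c Z = c Y := by
    intro Z hZ
    by_contra! hne
    have h1 := h.special_comparable h01 hZ hX hne.1
    have h2 := h.special_comparable h01 hZ hY hne.2
    have e1 := hno Z X Y hZ hX hY
    have e2 := hno X Z Y hX hZ hY
    have e3 := hno X Y Z hX hY hZ
    grind
  have hord : ∀ X' Y', c X' = c X → c Y' = c Y → X' < Y' := by
    intro X' Y' hX' hY'
    have hXs : Special c X' := by unfold Special at *; rwa [hX']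
    have hYs : Special c Y' := by unfold Special at *; rwa [hY']
    have h1 := h.special_comparable h01 hXs hYs (by grind)
    have h2 := h.special_comparable h01 hX hYs (by grind)
    have e1 := hno X Y' X' hX hYs hXs
    have e2 := hno Y' X Y hYs hX hY
    grind
  have htwo : IsTwoBlock c (c X) (c Y) := by
    refine ⟨h, h01, hXY, hX, hY, hab, hord, ?_, ?_⟩
    · intro Y' W hY' hlt hW
      have hYs : Special c Y' := by unfold Special at *; rwa [hY']
      exact hL _ _ _ (h.isLowerColoring h01 hX hYs hW (hord X Y' rfl hY') hlt (by grind))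
    · intro X' W hX' hlt hW
      have hXs : Special c X' := by unfold Special at *; rwa [hX']
      exact hL' _ _ _ (h.dual.isLowerColoring (X := OrderDual.toDual Y)
        (Y := OrderDual.toDual X') (W := OrderDual.toDual W) h01.symm ⟨hY.2, hY.1⟩
        ⟨hXs.2, hXs.1⟩ hW (hord X' Y hX' rfl) hlt (by simpa [hX'] using hXY.symm))
  rcases htwo.isSingletonColoring_or rfl rfl with hs | hs
  · exact hS _ _ hs
  · exact hS' _ _ hs

end Abstract

/-! ### Colorings of Types 1 to 4 are rainbow-free -/

section Abstract

variable {α κ : Type*}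

/-- A criterion for rainbow-freeness: only two colors occur outside a convex set `S`, so that a
rainbow copy has two members in `S`. These are the middle ones (excluded by `mono`), bottom and top
(excluded by `conv` and `mono`), bottom and a middle one (`up`), or a middle one and top
(`down`). -/
theorem rainbowFree_of_core [PartialOrder α] {c : α → κ} (S : α → Prop) (p q : κ)
    (conv : ∀ A Z D, S A → S D → A ≤ Z → Z ≤ D → S Z)
    (compl : ∀ Z, ¬ S Z → c Z = p ∨ c Z = q)
    (mono : ∀ P Q, S P → S Q → ¬ P ≤ Q → ¬ Q ≤ P → c P = c Q)
    (up : ∀ A P Q D, S A → S P → ¬ S Q → ¬ S D → A ≤ Q → P ≤ D → Q ≤ D → ¬ P ≤ Q → ¬ Q ≤ P →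
      c Q = c D)
    (down : ∀ A P Q D, S P → S D → ¬ S A → ¬ S Q → A ≤ P → A ≤ Q → P ≤ D → Q ≤ D → ¬ P ≤ Q →
      ¬ Q ≤ P → c A = c Q) : RainbowFree c := by
  intro A B C D hAB hAC hBD hCD hBC hCB
  have mBC := mono B C
  have vB := conv A B D
  have vC := conv A C D
  have uB := up A B C D
  have uC := up A C B D
  have dB := down A B C D
  have dC := down A C B D
  have kA := compl A
  have kB := compl B
  have kC := compl C
  have kD := compl D
  clear conv compl mono up down
  by_cases sA : S A <;> by_cases sB : S B <;> by_cases sC : S C <;> by_cases sD : S D <;>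
    simp only [sA, sB, sC, sD, hAB, hAC, hBD, hCD, hBC, hCB, not_true_eq_false, not_false_eq_true,
      forall_const, false_imp_iff, imp_false] at mBC vB vC uB uC dB dC kA kB kC kD <;>
    grind

theorem rainbowFree_of_interval [PartialOrder α] {c : α → κ} (X V : α) (b p q : κ)
    (mid : ∀ Z, X < Z → Z < V → c Z = b)
    (below : ∀ Z, Z ≤ V → ¬ X ≤ Z → c Z = p)
    (above : ∀ Z, X ≤ Z → ¬ Z ≤ V → c Z = q)
    (outside : ∀ Z, ¬ X ≤ Z → ¬ Z ≤ V → c Z = p ∨ c Z = q) : RainbowFree c := by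
  refine rainbowFree_of_core (fun Z => X ≤ Z ∧ Z ≤ V) p q ?_ ?_ ?_ ?_ ?_
  · exact fun A Z D hA hD hAZ hZD => ⟨hA.1.trans hAZ, hZD.trans hD.2⟩
  · intro Z hZ
    have := below Z
    have := above Z
    have := outside Z
    grind
  · rintro P Q ⟨h1, h2⟩ ⟨h3, h4⟩ hPQ hQP
    rw [mid P (h1.lt_of_not_ge fun h => hPQ (h.trans h3))
        (h2.lt_of_not_ge fun h => hQP (h4.trans h)),
      mid Q (h3.lt_of_not_ge fun h => hQP (h.trans h1))
        (h4.lt_of_not_ge fun h => hPQ (h2.trans h))]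
  · intro A P Q D hA hP hQ hD hAQ hPD hQD _ _
    have hXQ := hA.1.trans hAQ
    rw [above Q hXQ fun h => hQ ⟨hXQ, h⟩,
      above D (hXQ.trans hQD) fun h => hD ⟨hXQ.trans hQD, h⟩]
  · intro A P Q D hP hD hA hQ hAP hAQ hPD hQD _ _
    have hQV := hQD.trans hD.2
    rw [below Q hQV fun h => hQ ⟨h, hQV⟩, below A (hAQ.trans hQV) fun h => hA ⟨h, hAQ.trans hQV⟩]

theorem rainbowFree_of_lower [PartialOrder α] {c : α → κ} (X W : α) (b p q : κ)
    (mid : ∀ Z, X < Z → Z < W → c Z = b) (right : c W = p)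
    (below : ∀ Y, X < Y → Y < W → ∀ Z, Z ≤ Y → ¬ X ≤ Z → c Z = p)
    (above : ∀ Z, X ≤ Z → ¬ Z ≤ W → c Z = q)
    (outside : ∀ Z, ¬ X ≤ Z → c Z = p ∨ c Z = q) : RainbowFree c := by
  refine rainbowFree_of_core (fun Z => X ≤ Z ∧ Z < W) p q ?_ ?_ ?_ ?_ ?_
  · exact fun A Z D hA hD hAZ hZD => ⟨hA.1.trans hAZ, hZD.trans_lt hD.2⟩
  · intro Z hZ
    by_cases hX : X ≤ Z
    · by_cases hW : Z ≤ W
      · rcases hW.lt_or_eq with h | rfl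
        · exact absurd ⟨hX, h⟩ hZ
        · exact Or.inl right
      · exact Or.inr (above Z hX hW)
    · exact outside Z hX
  · rintro P Q ⟨h1, h2⟩ ⟨h3, h4⟩ hPQ hQP
    rw [mid P (h1.lt_of_not_ge fun h => hPQ (h.trans h3)) h2,
      mid Q (h3.lt_of_not_ge fun h => hQP (h.trans h1)) h4]
  · intro A P Q D hA hP hQ hD hAQ hPD hQD hPQ hQP
    have hXQ := hA.1.trans hAQ
    have hQW : ¬ Q ≤ W := fun h => hQ ⟨hXQ, h.lt_of_not_ge fun h' => hPQ (hP.2.le.trans h')⟩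
    rw [above Q hXQ hQW, above D (hXQ.trans hQD) fun h => hQW (hQD.trans h)]
  · intro A P Q D hP hD hA hQ hAP hAQ hPD hQD hPQ hQP
    have hXD : X < D := (hP.1.trans hPD).lt_of_not_ge fun h => hQP (hQD.trans (h.trans hP.1))
    rw [below D hXD hD.2 Q hQD fun h => hQ ⟨h, hQD.trans_lt hD.2⟩,
      below D hXD hD.2 A (hAQ.trans hQD) fun h => hA ⟨h, (hAQ.trans hQD).trans_lt hD.2⟩]

theorem rainbowFree_of_singleton [PartialOrder α] {c : α → κ} (X : α) (p q r : κ)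
    (above : ∀ Z, X < Z → c Z = q ∨ c Z = r)
    (below : ∀ Y, X < Y → c Y = r → ∀ Z, Z ≤ Y → ¬ X ≤ Z → c Z = p)
    (outside : ∀ Z, ¬ X ≤ Z → c Z = p ∨ c Z = q) : RainbowFree c := by
  intro A B C D hAB hAC hBD hCD hBC hCB
  have key : ∀ Z, Z ≠ X → c Z = p ∨ c Z = q ∨ c Z = r := by
    intro Z hZ
    by_cases h : X ≤ Z
    · have := above Z (h.lt_of_ne' hZ)
      grind
    · have := outside Z h
      grind
  have hX : ∀ P, ¬ P ≤ X → ¬ X ≤ P → A ≤ P → P ≤ D → X < D →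
      c A = c P ∨ c A = c D ∨ c P = c D := by
    intro P h1 h2 h3 h4 h5
    have e1 := above D h5
    have e2 := outside P h2
    have e3 := outside A fun h => h2 (h.trans h3)
    have e4 := fun h => below D h5 h P h4 h2
    have e5 := fun h => below D h5 h A (h3.trans h4) fun h => h2 (h.trans h3)
    grind
  by_cases hA : A = X
  · subst hA
    have e2 := above B (hAB.lt_of_not_ge fun h => hBC (h.trans hAC))
    have e3 := above C (hAC.lt_of_not_ge fun h => hCB (h.trans hAB))
    have e4 := above D ((hAB.trans hBD).lt_of_not_ge fun h => hBC (hBD.trans (h.trans hAC)))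
    grind
  by_cases hB : B = X
  · subst hB
    have := hX C hCB hBC hAC hCD (hBD.lt_of_not_ge fun h => hCB (hCD.trans h))
    grind
  by_cases hC : C = X
  · subst hC
    have := hX B hBC hCB hAB hBD (hCD.lt_of_not_ge fun h => hBC (hBD.trans h))
    grind
  by_cases hD : D = X
  · subst hD
    have e2 := outside B fun h => hCB (hCD.trans h)
    have e3 := outside C fun h => hBC (hBD.trans h)
    have e1 := outside A fun h => hCB (hCD.trans (h.trans hAB))
    grind
  have kA := key A hA
  have kB := key B hB
  have kC := key C hC
  have kD := key D hD
  clear key above below outside hX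
  grind

end Abstract

/-! ### Colorings of `B n` of Types 1 to 4 -/

variable {n k : ℕ} {c : B n → Fin k}

theorem not_hasRainbowInducedCopy_iff :
    ¬ HasRainbowInducedCopy (B 2) c ↔ RainbowFree c := by
  have hsub : ∀ S : B 2, S = ∅ ∨ S = {0} ∨ S = {1} ∨ S = {0, 1} := by decide
  constructor
  · intro h A X Y D hAX hAY hXD hYD hXY hYX
    by_contra! hne
    have hXA : ¬ X ≤ A := fun h => hXY (h.trans hAY)
    have hYA : ¬ Y ≤ A := fun h => hYX (h.trans hAX)
    have hDX : ¬ D ≤ X := fun h => hYX (hYD.trans h)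
    have hDY : ¬ D ≤ Y := fun h => hXY (hXD.trans h)
    have hAD := hAX.trans hXD
    have hDA : ¬ D ≤ A := fun h => hDX (h.trans hAX)
    let f : B 2 → B n := fun S =>
      if S = ∅ then A else if S = {0} then X else if S = {1} then Y else D
    have f0 : f ∅ = A := if_pos rfl
    have f1 : f {0} = X := by
      change (if _ then _ else _) = _
      rw [if_neg (by decide), if_pos rfl]
    have f2 : f {1} = Y := by
      change (if _ then _ else _) = _
      rw [if_neg (by decide), if_neg (by decide), if_pos rfl]
    have f3 : f {0, 1} = D := by
      change (if _ then _ else _) = _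
      rw [if_neg (by decide), if_neg (by decide), if_neg (by decide)]
    have hle : ∀ S T : B 2, f S ≤ f T ↔ S ≤ T := by
      intro S T
      rcases hsub S with rfl | rfl | rfl | rfl <;> rcases hsub T with rfl | rfl | rfl | rfl <;>
        simp only [f0, f1, f2, f3, hAX, hAY, hXD, hYD, hXY, hYX, hXA, hYA, hDX, hDY, hAD, hDA,
          le_refl, true_iff, false_iff] <;> decide
    refine h ⟨OrderEmbedding.ofMapLEIff f hle, fun S T hST => ?_⟩
    change c (f S) = c (f T) at hST
    rcases hsub S with rfl | rfl | rfl | rfl <;> rcases hsub T with rfl | rfl | rfl | rfl <;>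
      simp only [f0, f1, f2, f3] at hST ⊢ <;> grind
  · rintro h ⟨f, hf⟩
    have hlt : ∀ S T : B 2, f S ≤ f T ↔ S ≤ T := fun S T => f.le_iff_le
    have hc : ∀ S T : B 2, c (f S) = c (f T) → S = T := fun S T h => hf h
    have := h (f ∅) (f {0}) (f {1}) (f {0, 1}) ((hlt _ _).2 (by decide)) ((hlt _ _).2 (by decide))
      ((hlt _ _).2 (by decide)) ((hlt _ _).2 (by decide)) (by rw [hlt]; decide)
      (by rw [hlt]; decide)
    rcases this with h | h | h | h | h | h <;> exact absurd (hc _ _ h) (by decide)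

theorem exists_between_iff {X Y : B n} (h : X < Y) :
    X.card + 2 ≤ Y.card ↔ ∃ Z, X < Z ∧ Z < Y := by
  constructor
  · intro hc
    obtain ⟨Z, h1, h2, h3⟩ := Finset.exists_subsuperset_card_eq h.le (n := X.card + 1) (by omega)
      (by omega)
    refine ⟨Z, h1.lt_of_ne ?_, h2.lt_of_ne ?_⟩ <;> rintro rfl <;> omega
  · rintro ⟨Z, h1, h2⟩
    have := Finset.card_lt_card h1
    have := Finset.card_lt_card h2
    omega

theorem distinctMono_of_color {m : ℕ} {F : Fin m → Set (B n)} (col : Fin m → Fin k)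
    (hcol : Function.Injective col) (h : ∀ i, ∀ X ∈ F i, c X = col i) : DistinctMono c F := by
  refine ⟨fun i X hX Y hY => (h i X hX).trans (h i Y hY).symm, fun i j hij X hX Y hY he => ?_⟩
  exact hij (hcol (by rw [← h i X hX, ← h j Y hY, he]))

theorem rainbowFree_of_dual
    (h : RainbowFree (fun x : (B n)ᵒᵈ => c (OrderDual.ofDual x))) : RainbowFree c :=
  h.dual

theorem IsType1.rainbowFree (h : IsType1 c) : RainbowFree c := by
  obtain ⟨X, Y, hX, hXY, hY, hcard, ⟨hm, -⟩, hl⟩ := h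
  obtain ⟨M, hXM, hMY⟩ := (exists_between_iff hXY).1 hcard
  have below : ∀ Z, Z ≤ Y → ¬ X ≤ Z → c Z = c ∅ := fun Z h1 h2 =>
    hm 0 Z ⟨⟨bot_le, h1⟩, fun h => h2 h.1⟩ ∅ ⟨⟨le_rfl, bot_le⟩, fun h => hX.not_ge h.1⟩
  have above : ∀ Z, X ≤ Z → ¬ Z ≤ Y → c Z = c Finset.univ := fun Z h1 h2 =>
    hm 4 Z ⟨⟨h1, le_top⟩, fun h => h2 h.2⟩ _ ⟨⟨le_top, le_rfl⟩, fun h => hY.not_ge h.2⟩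
  refine rainbowFree_of_interval X Y (c M) (c ∅) (c Finset.univ)
    (fun Z h1 h2 => hm 2 Z ⟨h1, h2⟩ M ⟨hXM, hMY⟩) below above fun Z h1 h2 => ?_
  obtain ⟨T, hT | hT, hZT⟩ := hl Z ⟨trivial, by
    rintro (h | h)
    exacts [h2 h.2, h1 h.1]⟩
  · exact Or.inl (hZT.trans (below T hT.1.2 fun h => hT.2 ⟨h, hT.1.2⟩))
  · exact Or.inr (hZT.trans (above T hT.1.1 fun h => hT.2 ⟨hT.1.1, h⟩))

theorem IsType2.rainbowFree (h : IsType2 c) : RainbowFree c := by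
  obtain ⟨X, Y, hX, hXY, hY, hcard, ⟨hm, -⟩, hl⟩ := h
  obtain ⟨M, hXM, hMY⟩ := (exists_between_iff hXY).1 hcard
  have below : ∀ Z, Z ≤ Y → ¬ X ≤ Z → c Z = c ∅ := fun Z h1 h2 =>
    hm 0 Z ⟨⟨bot_le, h1⟩, fun h => h2 h.1⟩ ∅ ⟨⟨le_rfl, bot_le⟩, fun h => hX.not_ge h.1⟩
  have above : ∀ Z, X ≤ Z → ¬ Z ≤ Y → c Z = c Finset.univ := fun Z h1 h2 =>
    hm 3 Z ⟨⟨h1, le_top⟩, fun h => h2 h.2⟩ _ ⟨⟨le_top, le_rfl⟩, fun h => hY.not_ge h.2⟩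
  refine rainbowFree_of_interval X Y (c M) (c ∅) (c Finset.univ)
    (fun Z h1 h2 => hm 2 Z ⟨h1, h2⟩ M ⟨hXM, hMY⟩) below above fun Z h1 h2 => ?_
  obtain ⟨T, hT | hT, hZT⟩ := hl Z ⟨trivial, by
    rintro (h | h)
    exacts [h2 h.2, h1 h.1]⟩
  · exact Or.inl (hZT.trans (below T hT.1.2 fun h => hT.2 ⟨h, hT.1.2⟩))
  · exact Or.inr (hZT.trans (above T hT.1.1 fun h => hT.2 ⟨hT.1.1, h⟩))

theorem mem_upFamily {X Y Z : B n} : Z ∈ upFamily X Y ↔ ∃ M, X < M ∧ M < Y ∧ M ≤ Z := by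
  simp only [upFamily, Set.mem_iUnion, Set.mem_Ioo, Set.mem_Icc, exists_prop]
  exact ⟨fun ⟨M, h, h', _⟩ => ⟨M, h.1, h.2, h'⟩, fun ⟨M, h1, h2, h'⟩ => ⟨M, ⟨h1, h2⟩, h', le_top⟩⟩

theorem mem_downFamily {X Y Z : B n} : Z ∈ downFamily X Y ↔ ∃ M, X < M ∧ M < Y ∧ Z ≤ M := by
  simp only [downFamily, Set.mem_iUnion, Set.mem_Ioo, Set.mem_Icc, exists_prop]
  exact ⟨fun ⟨M, h, _, h'⟩ => ⟨M, h.1, h.2, h'⟩, fun ⟨M, h1, h2, h'⟩ => ⟨M, ⟨h1, h2⟩, bot_le, h'⟩⟩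

theorem IsType31.rainbowFree (h : IsType31 c) : RainbowFree c := by
  obtain ⟨X, Y, hX, hXY, hY, hcard, ⟨hm, -⟩, hl⟩ := h
  obtain ⟨M, hXM, hMY⟩ := (exists_between_iff hXY).1 hcard
  have below : ∀ Z, Z ≤ Y → ¬ X ≤ Z → c Z = c ∅ := fun Z h1 h2 =>
    hm 0 Z ⟨⟨bot_le, h1⟩, fun h => h2 h.1⟩ ∅ ⟨⟨le_rfl, bot_le⟩, fun h => hX.not_ge h.1⟩
  have hsnd : ∀ Z ∈ {X} ∪ (upFamily X Y \ Set.Ioc X Y), c Z = c X := fun Z hZ =>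
    hm 1 Z hZ X (Or.inl rfl)
  have above : ∀ P, X < P → P < Y → ∀ Z, P ≤ Z → ¬ Z ≤ Y → c Z = c X := fun P h1 h2 Z h3 h4 =>
    hsnd Z (Or.inr ⟨mem_upFamily.2 ⟨P, h1, h2, h3⟩, fun h => h4 h.2⟩)
  refine rainbowFree_of_dual (rainbowFree_of_lower (OrderDual.toDual Y) (OrderDual.toDual X) (c M)
    (c X) (c ∅) (fun Z h1 h2 => hm 2 _ ⟨h2, h1⟩ M ⟨hXM, hMY⟩) rfl
    (fun P h1 h2 Z => above _ h2 h1 Z) (fun Z => below Z) fun Z h1 => ?_)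
  by_cases hZ : OrderDual.ofDual Z ∈ upFamily X Y
  · obtain ⟨P, h2, h3, h4⟩ := mem_upFamily.1 hZ
    exact Or.inl (above P h2 h3 _ h4 h1)
  obtain ⟨T, hT | hT, hZT⟩ := hl (OrderDual.ofDual Z) ⟨trivial, by
    rintro (h | h)
    exacts [h1 h.2, hZ h]⟩
  · exact Or.inr (hZT.trans (below T hT.1.2 fun h => hT.2 ⟨h, hT.1.2⟩))
  · exact Or.inl (hZT.trans (hsnd T hT))

theorem IsType32.rainbowFree (h : IsType32 c) : RainbowFree c := by
  obtain ⟨X, Y, hX, hXY, hY, hcard, ⟨hm, -⟩, hl⟩ := h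
  obtain ⟨M, hXM, hMY⟩ := (exists_between_iff hXY).1 hcard
  have above : ∀ Z, X ≤ Z → ¬ Z ≤ Y → c Z = c Finset.univ := fun Z h1 h2 =>
    hm 0 Z ⟨⟨h1, le_top⟩, fun h => h2 h.2⟩ _ ⟨⟨le_top, le_rfl⟩, fun h => hY.not_ge h.2⟩
  have hsnd : ∀ Z ∈ {Y} ∪ (downFamily X Y \ Set.Ico X Y), c Z = c Y := fun Z hZ =>
    hm 1 Z hZ Y (Or.inl rfl)
  have below : ∀ P, X < P → P < Y → ∀ Z, Z ≤ P → ¬ X ≤ Z → c Z = c Y := fun P h1 h2 Z h3 h4 =>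
    hsnd Z (Or.inr ⟨mem_downFamily.2 ⟨P, h1, h2, h3⟩, fun h => h4 h.1⟩)
  refine rainbowFree_of_lower X Y (c M) (c Y) (c Finset.univ)
    (fun Z h1 h2 => hm 2 _ ⟨h1, h2⟩ M ⟨hXM, hMY⟩) rfl below above fun Z h1 => ?_
  by_cases hZ : Z ∈ downFamily X Y
  · obtain ⟨P, h2, h3, h4⟩ := mem_downFamily.1 hZ
    exact Or.inl (below P h2 h3 _ h4 h1)
  obtain ⟨T, hT | hT, hZT⟩ := hl Z ⟨trivial, by
    rintro (h | h)
    exacts [h1 h.1, hZ h]⟩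
  · exact Or.inr (hZT.trans (above T hT.1.1 fun h => hT.2 ⟨hT.1.1, h⟩))
  · exact Or.inl (hZT.trans (hsnd T hT))

theorem IsType41.rainbowFree (h : IsType41 c) : RainbowFree c := by
  obtain ⟨X, 𝒴, hX, -, h𝒴, ⟨Y₀, hY₀⟩, ⟨hm, hs⟩, hl⟩ := h
  have hX0 : ∅ < X := bot_lt_iff_ne_bot.2 (Finset.card_pos.1 hX).ne_empty
  have hfst : ∀ Z ∈ ⋃ Y ∈ 𝒴, (Set.Ico ∅ Y \ Set.Ico X Y), c Z = c ∅ := fun Z hZ =>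
    hm 0 Z hZ ∅ (Set.mem_biUnion hY₀ ⟨⟨le_rfl, hX0.trans (h𝒴 hY₀).1⟩, fun h => hX0.not_ge h.1⟩)
  have below : ∀ Y ∈ 𝒴, ∀ Z, Z ≤ Y → ¬ X ≤ Z → c Z = c ∅ := fun Y hY Z h1 h2 =>
    hfst Z (Set.mem_biUnion hY ⟨⟨bot_le, h1.lt_of_ne fun h => h2 (h ▸ (h𝒴 hY).1.le)⟩,
      fun h => h2 h.1⟩)
  obtain ⟨q, hq, hqY⟩ : ∃ q, (∀ Z ∈ Set.Ioc X Finset.univ \ 𝒴, c Z = q) ∧ q ≠ c Y₀ := by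
    -- The third family is empty if `𝒴` is all of `(X, [n]]`; its color is then irrelevant.
    by_cases hne : (Set.Ioc X Finset.univ \ 𝒴).Nonempty
    · obtain ⟨Q, hQ⟩ := hne
      exact ⟨c Q, fun Z hZ => hm 2 Z hZ Q hQ, hs 2 3 (by decide) Q hQ Y₀ hY₀⟩
    · exact ⟨c ∅, fun Z hZ => absurd ⟨Z, hZ⟩ hne, hs 0 3 (by decide) ∅
        (Set.mem_biUnion hY₀ ⟨⟨le_rfl, hX0.trans (h𝒴 hY₀).1⟩, fun h => hX0.not_ge h.1⟩) Y₀ hY₀⟩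
  refine rainbowFree_of_singleton X (c ∅) q (c Y₀) (fun Z hZ => ?_) (fun Y hXY hY => ?_)
    fun Z hXZ => ?_
  · by_cases h : Z ∈ 𝒴
    · exact Or.inr (hm 3 Z h Y₀ hY₀)
    · exact Or.inl (hq Z ⟨⟨hZ, le_top⟩, h⟩)
  · refine below Y ?_
    by_contra h
    exact hqY ((hq Y ⟨⟨hXY, le_top⟩, h⟩).symm.trans hY)
  · by_cases hZ : ∃ Y ∈ 𝒴, Z ≤ Y
    · obtain ⟨Y, hY, hZY⟩ := hZ
      exact Or.inl (below Y hY Z hZY hXZ)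
    obtain ⟨T, hT | hT, hZT⟩ := hl Z ⟨trivial, by
      rintro (h | h)
      · exact hXZ h.1
      · obtain ⟨Y, hY, h⟩ := Set.mem_iUnion₂.1 h
        exact hZ ⟨Y, hY, h.2.le⟩⟩
    · exact Or.inl (hZT.trans (hfst T hT))
    · exact Or.inr (hZT.trans (hq T hT))

theorem IsType42.rainbowFree (h : IsType42 c) : RainbowFree c := by
  obtain ⟨Y, 𝒳, -, hY, h𝒳, ⟨X₀, hX₀⟩, ⟨hm, hs⟩, hl⟩ := h
  have hY1 : Y < Finset.univ := (Finset.subset_univ Y).lt_of_ne (by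
    rintro rfl
    simp at hY)
  have htop : Finset.univ ∈ ⋃ X ∈ 𝒳, (Set.Ioc X Finset.univ \ Set.Ioc X Y) :=
    Set.mem_biUnion hX₀ ⟨⟨(h𝒳 hX₀).2.trans hY1, le_rfl⟩, fun h => hY1.not_ge h.2⟩
  have hfst : ∀ Z ∈ ⋃ X ∈ 𝒳, (Set.Ioc X Finset.univ \ Set.Ioc X Y), c Z = c Finset.univ :=
    fun Z hZ => hm 0 Z hZ _ htop
  have above : ∀ X ∈ 𝒳, ∀ Z, X ≤ Z → ¬ Z ≤ Y → c Z = c Finset.univ := fun X hX Z h1 h2 =>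
    hfst Z (Set.mem_biUnion hX ⟨⟨h1.lt_of_ne fun h => h2 (h ▸ (h𝒳 hX).2.le), le_top⟩,
      fun h => h2 h.2⟩)
  obtain ⟨q, hq, hqX⟩ : ∃ q, (∀ Z ∈ Set.Ico ∅ Y \ 𝒳, c Z = q) ∧ q ≠ c X₀ := by
    have hb : ∅ ∈ Set.Ico ∅ Y \ 𝒳 :=
      ⟨⟨le_rfl, (h𝒳 hX₀).1.trans (h𝒳 hX₀).2⟩, fun h => (h𝒳 h).1.ne rfl⟩
    exact ⟨c ∅, fun Z hZ => hm 2 Z hZ ∅ hb, hs 2 3 (by decide) ∅ hb X₀ hX₀⟩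
  refine rainbowFree_of_dual (rainbowFree_of_singleton (OrderDual.toDual Y) (c Finset.univ) q (c X₀)
    (fun Z hZ => ?_) (fun X hXY hX => ?_) fun Z hZY => ?_)
  · by_cases h : OrderDual.ofDual Z ∈ 𝒳
    · exact Or.inr (hm 3 _ h X₀ hX₀)
    · exact Or.inl (hq _ ⟨⟨bot_le, hZ⟩, h⟩)
  · refine above (OrderDual.ofDual X) ?_
    by_contra h
    exact hqX ((hq _ ⟨⟨bot_le, hXY⟩, h⟩).symm.trans hX)
  · by_cases hZ : ∃ X ∈ 𝒳, X ≤ OrderDual.ofDual Z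
    · obtain ⟨X, hX, hXZ⟩ := hZ
      exact Or.inl (above X hX _ hXZ hZY)
    obtain ⟨T, hT | hT, hZT⟩ := hl (OrderDual.ofDual Z) ⟨trivial, by
      rintro (h | h)
      · exact hZY h.2
      · obtain ⟨X, hX, h⟩ := Set.mem_iUnion₂.1 h
        exact hZ ⟨X, hX, h.1.le⟩⟩
    · exact Or.inl (hZT.trans (hfst T hT))
    · exact Or.inr (hZT.trans (hq T hT))

theorem IsIntervalColoring.isType {X V : B n} {b : Fin k} (h : IsIntervalColoring c X V b) :
    IsType1 c ∨ IsType2 c := by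
  obtain ⟨hne, hX, hV, hb, ⟨M, hXM, hMV⟩, mid, below, above, outside⟩ := h
  have hX0 : ∅ < X := bot_lt_iff_ne_bot.2 fun h => hX.1 (congrArg c h)
  have hV1 : V < Finset.univ := lt_top_iff_ne_top.2 fun h => hV.2 (congrArg c h)
  have hXV := hXM.trans hMV
  have hcard := (exists_between_iff hXV).2 ⟨M, hXM, hMV⟩
  have hlike : ColoredLike c (Set.univ \ (Set.Icc ∅ V ∪ Set.Icc X Finset.univ))
      (Set.Icc ∅ V \ Set.Icc X V) (Set.Icc X Finset.univ \ Set.Icc X V) := by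
    rintro Z ⟨-, hZ⟩
    rcases outside Z (fun h => hZ (Or.inr ⟨h, le_top⟩))
      (fun h => hZ (Or.inl ⟨bot_le, h⟩)) with h | h
    · exact ⟨∅, Or.inl ⟨⟨le_rfl, bot_le⟩, fun h => hX0.not_ge h.1⟩, h⟩
    · exact ⟨Finset.univ, Or.inr ⟨⟨le_top, le_rfl⟩, fun h => hV1.not_ge h.2⟩, h⟩
  have hbelow : ∀ Z ∈ Set.Icc ∅ V \ Set.Icc X V, c Z = c ∅ := fun Z hZ =>
    below Z hZ.1.2 fun h => hZ.2 ⟨h, hZ.1.2⟩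
  have habove : ∀ Z ∈ Set.Icc X Finset.univ \ Set.Icc X V, c Z = c Finset.univ := fun Z hZ =>
    above Z hZ.1.1 fun h => hZ.2 ⟨hZ.1.1, h⟩
  change c ∅ ≠ c Finset.univ at hne
  change c X ≠ c ∅ ∧ c X ≠ c Finset.univ at hX
  change c V ≠ c ∅ ∧ c V ≠ c Finset.univ at hV
  change b ≠ c ∅ ∧ b ≠ c Finset.univ ∧ _ at hb
  by_cases hXVc : c X = c V
  · refine Or.inr ⟨X, V, hX0, hXV, hV1, hcard,
      distinctMono_of_color ![c ∅, c X, b, c Finset.univ] ?_ ?_, hlike⟩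
    · intro i j
      fin_cases i <;> fin_cases j <;> simp <;> grind
    · intro i
      fin_cases i
      · exact hbelow
      · rintro Z (rfl | rfl)
        exacts [rfl, hXVc.symm]
      · exact fun Z hZ => mid Z hZ.1 hZ.2
      · exact habove
  · refine Or.inl ⟨X, V, hX0, hXV, hV1, hcard,
      distinctMono_of_color ![c ∅, c X, b, c V, c Finset.univ] ?_ ?_, hlike⟩
    · intro i j
      fin_cases i <;> fin_cases j <;> simp <;> grind
    · intro i
      fin_cases i
      · exact hbelow
      · rintro Z rfl
        rfl
      · exact fun Z hZ => mid Z hZ.1 hZ.2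
      · rintro Z rfl
        rfl
      · exact habove

theorem IsLowerColoring.isType32 {X W : B n} {b : Fin k} (h : IsLowerColoring c X W b) :
    IsType32 c := by
  obtain ⟨hne, hX, hb, ⟨M, hXM, hMW⟩, mid, hW, above, below, outside⟩ := h
  have hX0 : ∅ < X := bot_lt_iff_ne_bot.2 fun h => hX.1 (congrArg c h)
  have hW1 : W < Finset.univ := lt_top_iff_ne_top.2 fun h => hne (hW.symm.trans (congrArg c h))
  have hXW := hXM.trans hMW
  change c ∅ ≠ c Finset.univ at hne
  change c X ≠ c ∅ ∧ c X ≠ c Finset.univ at hX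
  change b ≠ c ∅ ∧ b ≠ c Finset.univ ∧ _ at hb
  refine ⟨X, W, hX0, hXW, hW1, (exists_between_iff hXW).2 ⟨M, hXM, hMW⟩,
    distinctMono_of_color ![c Finset.univ, c ∅, b, c X] ?_ ?_, ?_⟩
  · intro i j
    fin_cases i <;> fin_cases j <;> simp <;> grind
  · intro i
    fin_cases i
    · exact fun Z hZ => above Z hZ.1.1 fun h => hZ.2 ⟨hZ.1.1, h⟩
    · rintro Z (rfl | ⟨h1, h2⟩)
      · exact hW
      · obtain ⟨P, hXP, hPW, hZP⟩ := mem_downFamily.1 h1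
        exact below P hXP hPW Z hZP fun h => h2 ⟨h, hZP.trans_lt hPW⟩
    · exact fun Z hZ => mid Z hZ.1 hZ.2
    · rintro Z rfl
      rfl
  · rintro Z ⟨-, hZ⟩
    rcases outside Z (fun h => hZ (Or.inl ⟨h, le_top⟩)) with h | h
    · exact ⟨W, Or.inr (Or.inl rfl), h.trans hW.symm⟩
    · exact ⟨Finset.univ, Or.inl ⟨⟨le_top, le_rfl⟩, fun h => hW1.not_ge h.2⟩, h⟩

theorem IsLowerColoring.isType31 {W Y : (B n)ᵒᵈ} {b : Fin k}
    (h : IsLowerColoring (fun x : (B n)ᵒᵈ => c (OrderDual.ofDual x)) Y W b) : IsType31 c := by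
  obtain ⟨hne, hY, hb, ⟨M, hXM, hMW⟩, mid, hW, above, below, outside⟩ := h
  obtain ⟨X, rfl⟩ := OrderDual.toDual.surjective W
  obtain ⟨Y, rfl⟩ := OrderDual.toDual.surjective Y
  obtain ⟨M, rfl⟩ := OrderDual.toDual.surjective M
  change c Finset.univ ≠ c ∅ at hne
  change c Y ≠ c Finset.univ ∧ c Y ≠ c ∅ at hY
  change b ≠ c Finset.univ ∧ b ≠ c ∅ ∧ b ≠ c Y at hb
  change c X = c Finset.univ at hW
  change M < Y at hXM
  change X < M at hMW
  have hY1 : Y < Finset.univ := lt_top_iff_ne_top.2 fun h => hY.1 (congrArg c h)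
  have hX0 : ∅ < X := bot_lt_iff_ne_bot.2 fun h => hne (hW.symm.trans (congrArg c h))
  have hXY := hMW.trans hXM
  refine ⟨X, Y, hX0, hXY, hY1, (exists_between_iff hXY).2 ⟨M, hMW, hXM⟩,
    distinctMono_of_color ![c ∅, c Finset.univ, b, c Y] ?_ ?_, ?_⟩
  · intro i j
    fin_cases i <;> fin_cases j <;> simp <;> grind
  · intro i
    fin_cases i
    · exact fun Z hZ => above (OrderDual.toDual Z) hZ.1.2 fun h => hZ.2 ⟨h, hZ.1.2⟩
    · rintro Z (rfl | ⟨h1, h2⟩)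
      · exact hW
      · obtain ⟨P, hXP, hPY, hPZ⟩ := mem_upFamily.1 h1
        exact below (OrderDual.toDual P) hPY hXP (OrderDual.toDual Z) hPZ
          fun h => h2 ⟨hXP.trans_le hPZ, h⟩
    · exact fun Z hZ => mid (OrderDual.toDual Z) hZ.2 hZ.1
    · rintro Z rfl
      rfl
  · rintro Z ⟨-, hZ⟩
    rcases outside (OrderDual.toDual Z) (fun h => hZ (Or.inl ⟨bot_le, h⟩)) with h | h
    · exact ⟨X, Or.inr (Or.inl rfl), h.trans hW.symm⟩
    · exact ⟨∅, Or.inl ⟨⟨le_rfl, bot_le⟩, fun h => hX0.not_ge h.1⟩, h⟩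

theorem IsSingletonColoring.isType41 {X : B n} {b : Fin k} (h : IsSingletonColoring c X b) :
    IsType41 c := by
  obtain ⟨hne, hX, hb, ⟨Y₀, hXY₀, hY₀⟩, above, below, outside⟩ := h
  have hX0 : ∅ < X := bot_lt_iff_ne_bot.2 fun h => hX.1 (congrArg c h)
  have hX1 : X < Finset.univ := lt_top_iff_ne_top.2 fun h => hX.2 (congrArg c h)
  have hY1 : Y₀ < Finset.univ := lt_top_iff_ne_top.2 fun h =>
    hb.2.1 (hY₀.symm.trans (congrArg c h))
  change c ∅ ≠ c Finset.univ at hne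
  change c X ≠ c ∅ ∧ c X ≠ c Finset.univ at hX
  change b ≠ c ∅ ∧ b ≠ c Finset.univ ∧ _ at hb
  refine ⟨X, {Y | X < Y ∧ c Y = b}, Finset.card_pos.2 (Finset.nonempty_iff_ne_empty.2 hX0.ne'), ?_,
    fun Y hY => ⟨hY.1, le_top⟩, ⟨Y₀, hXY₀, hY₀⟩,
    distinctMono_of_color ![c ∅, c X, c Finset.univ, b] ?_ ?_, ?_⟩
  · simpa using (exists_between_iff hX1).2 ⟨Y₀, hXY₀, hY1⟩
  · intro i j
    fin_cases i <;> fin_cases j <;> simp <;> grind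
  · intro i
    fin_cases i
    · intro Z hZ
      obtain ⟨Y, hY, h1, h2⟩ := Set.mem_iUnion₂.1 hZ
      exact below Y hY.1 hY.2 Z h1.2.le fun h => h2 ⟨h, h1.2⟩
    · rintro Z rfl
      rfl
    · exact fun Z hZ => (above Z hZ.1.1).resolve_left fun h => hZ.2 ⟨hZ.1.1, h⟩
    · exact fun Z hZ => hZ.2
  · rintro Z ⟨-, hZ⟩
    rcases outside Z (fun h => hZ (Or.inl ⟨h, le_top⟩)) with h | h
    · exact ⟨∅, Or.inl (Set.mem_biUnion (x := Y₀) ⟨hXY₀, hY₀⟩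
        ⟨⟨le_rfl, hX0.trans hXY₀⟩, fun h => hX0.not_ge h.1⟩), h⟩
    · exact ⟨Finset.univ, Or.inr ⟨⟨hX1, le_rfl⟩, fun h => hb.2.1 h.2.symm⟩, h⟩

theorem IsSingletonColoring.isType42 {Y : (B n)ᵒᵈ} {b : Fin k}
    (h : IsSingletonColoring (fun x : (B n)ᵒᵈ => c (OrderDual.ofDual x)) Y b) : IsType42 c := by
  obtain ⟨hne, hY, hb, ⟨X₀, hXY₀, hX₀⟩, below, above, outside⟩ := h
  obtain ⟨Y, rfl⟩ := OrderDual.toDual.surjective Y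
  obtain ⟨X₀, rfl⟩ := OrderDual.toDual.surjective X₀
  change c Finset.univ ≠ c ∅ at hne
  change c Y ≠ c Finset.univ ∧ c Y ≠ c ∅ at hY
  change b ≠ c Finset.univ ∧ b ≠ c ∅ ∧ b ≠ c Y at hb
  change c X₀ = b at hX₀
  change X₀ < Y at hXY₀
  have hY0 : ∅ < Y := bot_lt_iff_ne_bot.2 fun h => hY.2 (congrArg c h)
  have hY1 : Y < Finset.univ := lt_top_iff_ne_top.2 fun h => hY.1 (congrArg c h)
  have hX0 : ∀ X, c X = b → ∅ < X := fun X hX => bot_lt_iff_ne_bot.2 fun h =>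
    hb.2.1 (hX.symm.trans (congrArg c h))
  refine ⟨Y, {X | X < Y ∧ c X = b}, ?_, ?_, fun X hX => ⟨hX0 X hX.2, hX.1⟩, ⟨X₀, hXY₀, hX₀⟩,
    distinctMono_of_color ![c Finset.univ, c Y, c ∅, b] ?_ ?_, ?_⟩
  · simpa using (exists_between_iff hY0).2 ⟨X₀, hX0 X₀ hX₀, hXY₀⟩
  · simpa using Finset.card_lt_card hY1
  · intro i j
    fin_cases i <;> fin_cases j <;> simp <;> grind
  · intro i
    fin_cases i
    · intro Z hZ
      obtain ⟨X, hX, h1, h2⟩ := Set.mem_iUnion₂.1 hZ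
      exact above (OrderDual.toDual X) hX.1 hX.2 (OrderDual.toDual Z) h1.1.le
        fun h => h2 ⟨h1.1, h⟩
    · rintro Z rfl
      rfl
    · exact fun Z hZ => (below (OrderDual.toDual Z) hZ.1.2).resolve_left
        fun h => hZ.2 ⟨hZ.1.2, h⟩
    · exact fun Z hZ => hZ.2
  · rintro Z ⟨-, hZ⟩
    rcases outside (OrderDual.toDual Z) (fun h => hZ (Or.inl ⟨bot_le, h⟩)) with h | h
    · exact ⟨Finset.univ, Or.inl (Set.mem_biUnion (x := X₀) ⟨hXY₀, hX₀⟩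
        ⟨⟨hXY₀.trans hY1, le_rfl⟩, fun h => hY1.not_ge h.2⟩), h⟩
    · exact ⟨∅, Or.inr ⟨⟨le_rfl, hY0⟩, fun h => hb.2.1 h.2.symm⟩, h⟩

theorem IsType1.eq_five (h : IsType1 c) (hc : IsExact c) : k = 5 := by
  obtain ⟨X, Y, hX, hXY, hY, hcard, ⟨hm, hs⟩, hl⟩ := h
  obtain ⟨M, hXM, hMY⟩ := (exists_between_iff hXY).1 hcard
  have hb : ∅ ∈ Set.Icc ∅ Y \ Set.Icc X Y := ⟨⟨le_rfl, bot_le⟩, fun h => hX.not_ge h.1⟩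
  have ht : Finset.univ ∈ Set.Icc X Finset.univ \ Set.Icc X Y :=
    ⟨⟨le_top, le_rfl⟩, fun h => hY.not_ge h.2⟩
  have hrep : ∀ i : Fin 5, ![∅, X, M, Y, Finset.univ] i ∈ ![Set.Icc ∅ Y \ Set.Icc X Y,
        {X}, Set.Ioo X Y, {Y}, Set.Icc X Finset.univ \ Set.Icc X Y] i := by
    intro i
    fin_cases i
    exacts [hb, rfl, ⟨hXM, hMY⟩, rfl, ht]
  have hbij : Function.Bijective fun i => c (![∅, X, M, Y, Finset.univ] i) := by
    constructor
    · intro i j hij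
      by_contra hne
      exact hs i j hne _ (hrep i) _ (hrep j) hij
    · intro a
      obtain ⟨Z, rfl⟩ := hc a
      have hfam : ∀ i, ∀ Z ∈ ![Set.Icc ∅ Y \ Set.Icc X Y,
        {X}, Set.Ioo X Y, {Y}, Set.Icc X Finset.univ \ Set.Icc X Y] i,
          c (![∅, X, M, Y, Finset.univ] i) = c Z := fun i Z hZ => hm i _ (hrep i) Z hZ
      by_cases h1 : X ≤ Z
      · by_cases h2 : Z ≤ Y
        · rcases h1.eq_or_lt with rfl | h1
          · exact ⟨1, rfl⟩
          rcases h2.eq_or_lt with rfl | h2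
          · exact ⟨3, rfl⟩
          exact ⟨2, hfam 2 Z ⟨h1, h2⟩⟩
        · exact ⟨4, hfam 4 Z ⟨⟨h1, le_top⟩, fun h => h2 h.2⟩⟩
      · by_cases h2 : Z ≤ Y
        · exact ⟨0, hfam 0 Z ⟨⟨bot_le, h2⟩, fun h => h1 h.1⟩⟩
        · obtain ⟨T, hT | hT, hZT⟩ := hl Z ⟨trivial, by
            rintro (h | h)
            exacts [h2 h.2, h1 h.1]⟩
          · exact ⟨0, (hfam 0 T hT).trans hZT.symm⟩
          · exact ⟨4, (hfam 4 T hT).trans hZT.symm⟩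
  simpa using (Fintype.card_of_bijective hbij).symm

/-! ### Equal colors of bottom and top -/

section Abstract

variable {α κ : Type*} [BooleanAlgebra α] {c : α → κ}

/-- The structure that a coloring of Type 5 has around a rainbow chain `W < X < Y` without the
color of `⊤`, where `b` is the color of `X`, pointwise and over any Boolean algebra. -/
structure IsBlock (c : α → κ) (W Y : α) (b : κ) : Prop where
  mid : ∀ Z, W < Z → Z < Y → c Z = b
  below : ∀ P, W < P → P < Y → ∀ Z, Z ≤ P → ¬ W ≤ Z → c Z = c ⊥
  above : ∀ P, W < P → P < Y → ∀ Z, P ≤ Z → ¬ Z ≤ Y → c Z = c ⊤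
  below_right : ∀ Z, Z ≤ Y → ¬ W ≤ Z → c Z = c ⊥ ∨ c Z = c Y
  above_left : ∀ Z, W ≤ Z → ¬ Z ≤ Y → c Z = c ⊤ ∨ c Z = c W

theorem RainbowFree.mid_of_chain (h : RainbowFree c) (h01 : c ⊥ = c ⊤) {W X Y : α}
    (hW : c W ≠ c ⊤) (hX : c X ≠ c ⊤) (hY : c Y ≠ c ⊤) (hWX : W < X) (hXY : X < Y)
    (h1 : c W ≠ c X) (h2 : c W ≠ c Y) (h3 : c X ≠ c Y) : ∀ Z, W < Z → Z < Y → c Z = c X := by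
  refine interval_induction (p := fun Z => c Z = c X) ?_ hWX hXY rfl
  intro P Q hWP hPY hWQ hQY hPQ hQP hP
  have e1 := h W P Q Y hWP.le hWQ.le hPY.le hQY.le hPQ hQP
  have e2 := h ⊥ P Q Y bot_le bot_le hPY.le hQY.le hPQ hQP
  have e3 := h W P Q ⊤ hWP.le hWQ.le le_top le_top hPQ hQP
  grind

theorem RainbowFree.below_of_chain (h : RainbowFree c) (h01 : c ⊥ = c ⊤) {W X Y : α}
    (hW : c W ≠ c ⊤) (hX : c X ≠ c ⊤) (hY : c Y ≠ c ⊤) (hWX : W < X) (hXY : X < Y)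
    (h1 : c W ≠ c X) (h2 : c W ≠ c Y) (h3 : c X ≠ c Y) :
    (∀ P, W < P → P < Y → ∀ Z, Z ≤ P → ¬ W ≤ Z → c Z = c ⊥) ∧
      ∀ Z, Z ≤ Y → ¬ W ≤ Z → c Z = c ⊥ ∨ c Z = c Y := by
  have hmid := h.mid_of_chain h01 hW hX hY hWX hXY h1 h2 h3
  have hinc : ∀ P, W < P → P < Y → ∀ Z, Z ≤ P → ¬ W ≤ Z → ¬ Z ≤ W → c Z = c ⊥ := by
    intro P hWP hPY Z hZP hWZ hZW
    have hcP := hmid P hWP hPY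
    obtain ⟨Q, hWQ, hQY, hQ, -⟩ := exists_incomparable hWP hPY
    have hZQ := hQ Z hZP hZW
    have hcQ := hmid Q hWQ hQY
    have e1 := h ⊥ Z W P bot_le bot_le hZP hWP.le hZW hWZ
    have e2 := h ⊥ Z W Y bot_le bot_le (hZP.trans hPY.le) (hWP.trans hPY).le hZW hWZ
    have e3 := h ⊥ Z Q Y bot_le bot_le (hZP.trans hPY.le) hQY.le hZQ.1 hZQ.2
    grind
  have hbelow : ∀ P, W < P → P < Y → ∀ Z, Z ≤ P → ¬ W ≤ Z → c Z = c ⊥ := by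
    intro P hWP hPY Z hZP hWZ
    by_cases hZW : Z ≤ W
    · have hlt := hZW.lt_of_not_ge hWZ
      have hcP := hmid P hWP hPY
      obtain ⟨R, hZR, hRP, hR, -⟩ := exists_incomparable hlt hWP
      have hRW := hR W le_rfl hWZ
      have hcR := hinc P hWP hPY R hRP.le hRW.1 hRW.2
      obtain ⟨Q, hWQ, hQY, hQ, -⟩ := exists_incomparable hWP hPY
      have hRQ := hQ R hRP.le hRW.2
      have hcQ := hmid Q hWQ hQY
      have e1 := h Z R Q Y hZR.le (hlt.trans hWQ).le (hRP.trans hPY).le hQY.le hRQ.1 hRQ.2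
      have e2 := h Z R W Y hZR.le hlt.le (hRP.trans hPY).le (hWP.trans hPY).le hRW.2 hRW.1
      have e3 := h Z R W P hZR.le hlt.le hRP.le hWP.le hRW.2 hRW.1
      grind
    · exact hinc P hWP hPY Z hZP hWZ hZW
  refine ⟨hbelow, fun Z hZY hWZ => ?_⟩
  by_cases hZX : Z ≤ X
  · exact Or.inl (hbelow X hWX hXY Z hZX hWZ)
  have e1 := h ⊥ X Z Y bot_le bot_le hXY.le hZY (fun h => hWZ (hWX.le.trans h)) hZX
  have e2 := h ⊥ W Z Y bot_le bot_le (hWX.trans hXY).le hZY hWZ fun h => hZX (h.trans hWX.le)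
  grind

theorem RainbowFree.isBlock (h : RainbowFree c) (h01 : c ⊥ = c ⊤) {W X Y : α}
    (hW : c W ≠ c ⊤) (hX : c X ≠ c ⊤) (hY : c Y ≠ c ⊤) (hWX : W < X) (hXY : X < Y)
    (h1 : c W ≠ c X) (h2 : c W ≠ c Y) (h3 : c X ≠ c Y) : IsBlock c W Y (c X) := by
  have hb := h.below_of_chain h01 hW hX hY hWX hXY h1 h2 h3
  have ha := h.dual.below_of_chain (W := OrderDual.toDual Y) (X := OrderDual.toDual X)
    (Y := OrderDual.toDual W) h01.symm (h01 ▸ hY :) (h01 ▸ hX :) (h01 ▸ hW :) hXY hWX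
    h3.symm h2.symm h1.symm
  exact ⟨h.mid_of_chain h01 hW hX hY hWX hXY h1 h2 h3, hb.1,
    fun P hWP hPY Z hPZ hZY => ha.1 (OrderDual.toDual P) hPY hWP (OrderDual.toDual Z) hPZ hZY, hb.2,
    fun Z hWZ hZY => ha.2 (OrderDual.toDual Z) hWZ hZY⟩

/-- With equal bottom and top colors, four elements of a chain that avoid this color cannot have
pairwise distinct colors: the open interval from the first to the last would be monochromatic. -/
theorem RainbowFree.no_long_chain (h : RainbowFree c) (h01 : c ⊥ = c ⊤) {W X Y V : α}
    (hW : c W ≠ c ⊤) (hX : c X ≠ c ⊤) (hV : c V ≠ c ⊤) (hWX : W < X) (hXY : X < Y) (hYV : Y < V)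
    (h1 : c W ≠ c X) (h2 : c W ≠ c V) (h3 : c X ≠ c Y) (h4 : c X ≠ c V) : False :=
  h3.symm (h.mid_of_chain h01 hW hX hV hWX (hXY.trans hYV) h1 h2 h4 Y (hWX.trans hXY) hYV)

/-- Colorings of Type 5 are rainbow-free. At most one member of a copy has the color of `⊤`. If it
is a middle one or none, the other three form a chain whose block contains the fourth; if it is the
bottom or the top, `hext` applies to the other end and a middle member. -/
theorem rainbowFree_of_blocks (h01 : c ⊥ = c ⊤)
    (hblock : ∀ W X Y : α, c W ≠ c ⊤ → c X ≠ c ⊤ → c Y ≠ c ⊤ → W < X → X < Y → c W ≠ c X →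
      c W ≠ c Y → c X ≠ c Y → IsBlock c W Y (c X))
    (hext : ∀ W Y : α, W < Y → c W ≠ c ⊤ → c Y ≠ c ⊤ → c W ≠ c Y →
      (∃ Z, (Z < W ∨ W < Z ∧ Z < Y ∨ Y < Z) ∧ c Z ≠ c W ∧ c Z ≠ c Y ∧ c Z ≠ c ⊤) ∨
      ∀ Z, Z ≤ Y ∨ W ≤ Z → c Z = c W ∨ c Z = c Y ∨ c Z = c ⊤) : RainbowFree c := by
  intro A P Q D hAP hAQ hPD hQD hPQ hQP
  by_contra! hne
  obtain ⟨n1, n2, n3, n4, n5, n6⟩ := hne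
  have lAP : A < P := hAP.lt_of_not_ge fun h => hPQ (h.trans hAQ)
  have lAQ : A < Q := hAQ.lt_of_not_ge fun h => hQP (h.trans hAP)
  have lPD : P < D := hPD.lt_of_not_ge fun h => hQP (hQD.trans h)
  have lQD : Q < D := hQD.lt_of_not_ge fun h => hPQ (hPD.trans h)
  by_cases hD : c D = c ⊤
  · rw [hD] at n3 n5 n6
    rcases hext A P lAP n3 n5 n1 with ⟨Z, hZ, m1, m2, m3⟩ | hall
    · rcases hZ with hZ | ⟨hZ, hZ'⟩ | hZ
      · exact n6 ((hblock Z A P m3 n3 n5 hZ lAP m1 m2 n1).above A hZ lAP Q hAQ hQP)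
      · rcases (hblock A Z P n3 m3 n5 hZ hZ' m1.symm n1 m2).above_left Q hAQ hQP with h | h
        exacts [n6 h, n2 h.symm]
      · have hb := hblock A P Z n3 n5 m3 lAP hZ n1 m1.symm m2.symm
        by_cases hQZ : Q ≤ Z
        · exact n4 (hb.mid Q lAQ (hQZ.lt_of_ne fun h => hPQ (h ▸ hZ.le))).symm
        · rcases hb.above_left Q hAQ hQZ with h | h
          exacts [n6 h, n2 h.symm]
    · rcases hall Q (Or.inr hAQ) with h | h | h
      exacts [n2 h.symm, n4 h.symm, n6 h]
  by_cases hA : c A = c ⊤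
  · rw [hA] at n1 n2
    rcases hext P D lPD n1.symm hD n5 with ⟨Z, hZ, m1, m2, m3⟩ | hall
    · rcases hZ with hZ | ⟨hZ, hZ'⟩ | hZ
      · have hb := hblock Z P D m3 n1.symm hD hZ lPD m1 m2 n5
        by_cases hQZ : Z ≤ Q
        · exact n4 (hb.mid Q (hQZ.lt_of_ne fun h => hQP (h ▸ hZ.le)) lQD).symm
        · rcases hb.below_right Q hQD hQZ with h | h
          exacts [n2 (h.trans h01).symm, n6 h]
      · rcases (hblock P Z D n1.symm m3 hD hZ hZ' m1.symm n5 m2).below_right Q hQD hPQ with h | h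
        exacts [n2 (h.trans h01).symm, n6 h]
      · exact n2 (((hblock P D Z n1.symm hD m3 lPD hZ n5 m1.symm m2.symm).below D lPD hZ Q hQD
          hPQ).trans h01).symm
    · rcases hall Q (Or.inl hQD) with h | h | h
      exacts [n4 h.symm, n6 h, n2 h.symm]
  by_cases hP : c P = c ⊤
  · exact n4 ((hblock A Q D hA (fun h => n4 (hP.trans h.symm)) hD lAQ lQD n2 n3 n6).mid P lAP lPD)
  · exact n4 ((hblock A P D hA hP hD lAP lPD n1 n3 n5).mid Q lAQ lQD).symm

end Abstract

/-! ### Colorings of `B n` of Type 5 -/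

theorem isRainbowChain_triple {X Y Z : B n} (hXY : X < Y) (hYZ : Y < Z) :
    IsRainbowChain c {X, Y, Z} ↔ c X ≠ c Y ∧ c X ≠ c Z ∧ c Y ≠ c Z := by
  have hXZ := hXY.trans hYZ
  constructor
  · rintro ⟨-, h⟩
    exact ⟨fun e => hXY.ne (h (by simp) (by simp) e), fun e => hXZ.ne (h (by simp) (by simp) e),
      fun e => hYZ.ne (h (by simp) (by simp) e)⟩
  · rintro ⟨h1, h2, h3⟩
    constructor
    · rintro P (rfl | rfl | rfl) Q (rfl | rfl | rfl) - <;>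
        simp only [hXY.le, hYZ.le, hXZ.le, le_refl, true_or, or_true]
    · rintro P (rfl | rfl | rfl) Q (rfl | rfl | rfl) e <;> grind

theorem isRainbowChain_quadruple {W X Y Z : B n} (hWX : W < X) (hXY : X < Y) (hYZ : Y < Z) :
    IsRainbowChain c {W, X, Y, Z} ↔
      c W ≠ c X ∧ c W ≠ c Y ∧ c W ≠ c Z ∧ c X ≠ c Y ∧ c X ≠ c Z ∧ c Y ≠ c Z := by
  have hXZ := hXY.trans hYZ
  have hWY := hWX.trans hXY
  have hWZ := hWX.trans hXZ
  constructor
  · rintro ⟨-, h⟩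
    exact ⟨fun e => hWX.ne (h (by simp) (by simp) e), fun e => hWY.ne (h (by simp) (by simp) e),
      fun e => hWZ.ne (h (by simp) (by simp) e), fun e => hXY.ne (h (by simp) (by simp) e),
      fun e => hXZ.ne (h (by simp) (by simp) e), fun e => hYZ.ne (h (by simp) (by simp) e)⟩
  · rintro ⟨h1, h2, h3, h4, h5, h6⟩
    constructor
    · rintro P (rfl | rfl | rfl | rfl) Q (rfl | rfl | rfl | rfl) - <;>
        simp only [hWX.le, hWY.le, hWZ.le, hXY.le, hYZ.le, hXZ.le, le_refl, true_or, or_true]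
    · rintro P (rfl | rfl | rfl | rfl) Q (rfl | rfl | rfl | rfl) e <;> grind

/-- A chain with more than `m` members has a least one, with at least `m` members above it. -/
theorem exists_least_of_chain {C : Set (B n)} (hC : IsChain (· ≤ ·) C) {m : ℕ}
    (hm : m + 1 ≤ C.ncard) : ∃ X ∈ C, ∃ C' ⊆ C, (∀ Y ∈ C', X < Y) ∧ m ≤ C'.ncard := by
  have hne : C.Nonempty := Set.nonempty_of_ncard_ne_zero (by omega)
  obtain ⟨X, hX⟩ := C.toFinite.exists_minimal hne
  refine ⟨X, hX.prop, C \ {X}, Set.sdiff_subset, fun Y hY => ?_, ?_⟩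
  · rcases hC hX.prop hY.1 (Ne.symm hY.2) with h | h
    · exact h.lt_of_ne (Ne.symm hY.2)
    · exact absurd (le_antisymm h (hX.le_of_le hY.1 h)) hY.2
  · have := Set.ncard_sdiff_singleton_add_one hX.prop
    omega

theorem RainbowFree.ncard_le_four (h : RainbowFree c) (h01 : c ∅ = c Finset.univ) {C : Set (B n)}
    (hC : IsRainbowChain c C) : C.ncard ≤ 4 := by
  by_contra! hcard
  have hT : 4 ≤ {Z ∈ C | c Z ≠ c Finset.univ}.ncard := by
    have h1 : {Z ∈ C | c Z = c Finset.univ}.ncard ≤ 1 :=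
      (Set.ncard_le_one_iff (Set.toFinite _)).2 fun ha hb => hC.2 ha.1 hb.1 (ha.2.trans hb.2.symm)
    have h2 : C = {Z ∈ C | c Z ≠ c Finset.univ} ∪ {Z ∈ C | c Z = c Finset.univ} := by
      ext Z
      simp only [Set.mem_union, Set.mem_ofPred_eq]
      tauto
    have h3 := Set.ncard_union_le {Z ∈ C | c Z ≠ c Finset.univ} {Z ∈ C | c Z = c Finset.univ}
    rw [← h2] at h3
    omega
  obtain ⟨W, hW, C₁, hC₁, hW₁, hm₁⟩ := exists_least_of_chain
    (hC.1.mono (Set.sep_subset C _)) hT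
  obtain ⟨X, hX, C₂, hC₂, hX₂, hm₂⟩ := exists_least_of_chain
    (hC.1.mono (hC₁.trans (Set.sep_subset C _))) hm₁
  obtain ⟨Y, hY, C₃, hC₃, hY₃, hm₃⟩ := exists_least_of_chain
    (hC.1.mono (hC₂.trans (hC₁.trans (Set.sep_subset C _)))) hm₂
  obtain ⟨V, hV⟩ : C₃.Nonempty := Set.nonempty_of_ncard_ne_zero (by omega)
  have hWX := hW₁ X hX
  have hXY := hX₂ Y hY
  have hYV := hY₃ V hV
  have mX := hC₁ hX
  have mY := hC₁ (hC₂ hY)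
  have mV := hC₁ (hC₂ (hC₃ hV))
  have hinj : ∀ P ∈ C, ∀ Q ∈ C, P < Q → c P ≠ c Q := fun P hP Q hQ hPQ e => hPQ.ne (hC.2 hP hQ e)
  exact h.no_long_chain h01 hW.2 mX.2 mV.2 hWX hXY hYV (hinj _ hW.1 _ mX.1 hWX)
    (hinj _ hW.1 _ mV.1 (hWX.trans (hXY.trans hYV))) (hinj _ mX.1 _ mY.1 hXY)
    (hinj _ mX.1 _ mV.1 (hXY.trans hYV))

/-- The extensions of a rainbow chain `W < Y < [n]` by a further member, which lies below `W`,
between `W` and `Y`, or above `Y`. -/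
theorem isRainbowChain_extension {W Y Z : B n} (hWY : W < Y) (hY : Y < Finset.univ)
    (hc : c W ≠ c Y ∧ c W ≠ c Finset.univ ∧ c Y ≠ c Finset.univ) :
    (Z ∉ ({W, Y, Finset.univ} : Set (B n)) ∧ IsRainbowChain c {Z, W, Y, Finset.univ}) ↔
      (Z < W ∨ W < Z ∧ Z < Y ∨ Y < Z) ∧ c Z ≠ c W ∧ c Z ≠ c Y ∧ c Z ≠ c Finset.univ := by
  constructor
  · rintro ⟨hZ, hch, hinj⟩
    have hZW : Z ≠ W := fun h => hZ (by simp [h])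
    have hZY : Z ≠ Y := fun h => hZ (by simp [h])
    have hZ1 : Z ≠ Finset.univ := fun h => hZ (by simp [h])
    refine ⟨?_, fun e => hZW (hinj (by simp) (by simp) e),
      fun e => hZY (hinj (by simp) (by simp) e),
      fun e => hZ1 (hinj (by simp) (by simp) e)⟩
    rcases hch (show Z ∈ _ by simp) (show W ∈ _ by simp) hZW with h | h
    · exact Or.inl (h.lt_of_ne hZW)
    rcases hch (show Z ∈ _ by simp) (show Y ∈ _ by simp) hZY with h' | h'
    · exact Or.inr (Or.inl ⟨h.lt_of_ne' hZW, h'.lt_of_ne hZY⟩)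
    · exact Or.inr (Or.inr (h'.lt_of_ne' hZY))
  · rintro ⟨hZ, h1, h2, h3⟩
    refine ⟨?_, ?_⟩
    · rintro (rfl | rfl | rfl)
      exacts [h1 rfl, h2 rfl, h3 rfl]
    · rcases hZ with h | ⟨h, h'⟩ | h
      · exact (isRainbowChain_quadruple h hWY hY).2 ⟨h1, h2, h3, hc⟩
      · rw [Set.insert_comm]
        exact (isRainbowChain_quadruple h h' hY).2 ⟨h1.symm, hc.1, hc.2.1, h2, h3, hc.2.2⟩
      · rw [Set.insert_comm, Set.insert_comm Z]
        exact (isRainbowChain_quadruple hWY h (lt_top_iff_ne_top.2 fun e => h3 (congrArg c e))).2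
          ⟨hc.1, h1.symm, hc.2.1, h2.symm, hc.2.2, h3⟩

theorem RainbowFree.isType5 (h : RainbowFree c) (h01 : c ∅ = c Finset.univ) : IsType5 c := by
  refine ⟨fun C hC => h.ncard_le_four h01 hC, fun W X Y hWX hXY hY hch => ?_,
    fun W Y hWY hY hch hext => ?_⟩
  · obtain ⟨h1, h2, h3, h4, h5, h6⟩ := (isRainbowChain_quadruple hWX hXY hY).1 hch
    have hb := h.isBlock h01 h3 h5 h6 hWX hXY h1 h2 h4
    have hW0 : ∅ < W := bot_lt_iff_ne_bot.2 fun e => h3 ((congrArg c e).trans h01)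
    have htop : Finset.univ ∈ (upFamily W Y ∪ downFamily W Y) \ Set.Icc W Y :=
      ⟨Or.inl (mem_upFamily.2 ⟨X, hWX, hXY, le_top⟩), fun h => hY.not_ge h.2⟩
    refine ⟨distinctMono_of_color ![c Finset.univ, c W, c X, c Y] ?_ ?_, ?_, ?_⟩
    · intro i j
      fin_cases i <;> fin_cases j <;> simp <;> grind
    · intro i
      fin_cases i
      · rintro Z ⟨hZ | hZ, hZ'⟩
        · obtain ⟨P, hWP, hPY, hPZ⟩ := mem_upFamily.1 hZ
          exact hb.above P hWP hPY Z hPZ fun h => hZ' ⟨hWP.le.trans hPZ, h⟩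
        · obtain ⟨P, hWP, hPY, hZP⟩ := mem_downFamily.1 hZ
          exact (hb.below P hWP hPY Z hZP fun h => hZ' ⟨h, hZP.trans hPY.le⟩).trans h01
      · rintro Z rfl
        rfl
      · exact fun Z hZ => hb.mid Z hZ.1 hZ.2
      · rintro Z rfl
        rfl
    · rintro Z ⟨⟨-, hZY⟩, hZ⟩
      have hWZ : ¬ W ≤ Z := by
        intro hWZ
        rcases hWZ.eq_or_lt with rfl | hlt
        · exact hZ (mem_downFamily.2 ⟨X, hWX, hXY, hWX.le⟩)
        · exact hZ (mem_downFamily.2 ⟨Z, hlt, hZY, le_rfl⟩)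
      rcases hb.below_right Z hZY.le hWZ with e | e
      · exact ⟨_, Or.inl htop, e.trans h01⟩
      · exact ⟨Y, Or.inr rfl, e⟩
    · rintro Z ⟨⟨hWZ, -⟩, hZ⟩
      have hZY : ¬ Z ≤ Y := by
        intro hZY
        rcases hZY.eq_or_lt with rfl | hlt
        · exact hZ (mem_upFamily.2 ⟨X, hWX, hXY, hXY.le⟩)
        · exact hZ (mem_upFamily.2 ⟨Z, hWZ, hlt, le_rfl⟩)
      rcases hb.above_left Z hWZ.le hZY with e | e
      · exact ⟨_, Or.inl htop, e⟩
      · exact ⟨W, Or.inr rfl, e⟩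
  · obtain ⟨h1, h2, h3⟩ := (isRainbowChain_triple hWY hY).1 hch
    -- A fourth color on a set comparable to `W` and `Y` extends the chain; on any other set it
    -- gives a rainbow copy with `∅` or `[n]`.
    refine Set.ncard_eq_three.2 ⟨c W, c Y, c Finset.univ, h1, h2, h3, ?_⟩
    have hno : ∀ Z, (Z < W ∨ W < Z ∧ Z < Y ∨ Y < Z) →
        c Z = c W ∨ c Z = c Y ∨ c Z = c Finset.univ := by
      intro Z hZ
      by_contra! hne
      exact hext ⟨Z, (isRainbowChain_extension hWY hY ⟨h1, h2, h3⟩).2 ⟨hZ, hne⟩⟩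
    apply Set.Subset.antisymm
    · rintro _ ⟨Z, hZ, rfl⟩
      change c Z = c W ∨ c Z = c Y ∨ c Z = c Finset.univ
      by_cases hZW : Z = W
      · exact Or.inl (congrArg c hZW)
      by_cases hZY : Z = Y
      · exact Or.inr (Or.inl (congrArg c hZY))
      rcases hZ with ⟨-, hZ⟩ | ⟨hZ, -⟩
      · by_cases l1 : Z ≤ W
        · exact hno Z (Or.inl (l1.lt_of_ne hZW))
        by_cases l2 : W ≤ Z
        · exact hno Z (Or.inr (Or.inl ⟨l2.lt_of_ne' hZW, hZ.lt_of_ne hZY⟩))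
        have := h ∅ Z W Y bot_le bot_le hZ hWY.le l1 l2
        grind
      · by_cases l1 : Y ≤ Z
        · exact hno Z (Or.inr (Or.inr (l1.lt_of_ne' hZY)))
        by_cases l2 : Z ≤ Y
        · exact hno Z (Or.inr (Or.inl ⟨hZ.lt_of_ne' hZW, l2.lt_of_ne hZY⟩))
        have := h W Y Z Finset.univ hWY.le hZ le_top le_top l1 l2
        grind
    · rintro _ (rfl | rfl | rfl)
      · exact ⟨W, Or.inr ⟨le_rfl, le_top⟩, rfl⟩
      · exact ⟨Y, Or.inl ⟨bot_le, le_rfl⟩, rfl⟩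
      · exact ⟨Finset.univ, Or.inr ⟨le_top, le_rfl⟩, rfl⟩

theorem IsType5.rainbowFree (h : IsType5 c) (h01 : c ∅ = c Finset.univ) : RainbowFree c := by
  obtain ⟨-, h4, h3⟩ := h
  have hlt : ∀ Y, c Y ≠ c ⊤ → Y < Finset.univ := fun Y hY =>
    lt_top_iff_ne_top.2 fun e => hY (congrArg c e)
  refine rainbowFree_of_blocks h01 ?_ ?_
  · intro W X Y hW hX hY hWX hXY h1 h2 h6
    obtain ⟨⟨hm, -⟩, hl, hl'⟩ := h4 W X Y hWX hXY (hlt Y hY)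
      ((isRainbowChain_quadruple hWX hXY (hlt Y hY)).2 ⟨h1, h2, hW, h6, hX, hY⟩)
    have htop : Finset.univ ∈ (upFamily W Y ∪ downFamily W Y) \ Set.Icc W Y :=
      ⟨Or.inl (mem_upFamily.2 ⟨X, hWX, hXY, le_top⟩), fun h => (hlt Y hY).not_ge h.2⟩
    have hfst : ∀ Z ∈ (upFamily W Y ∪ downFamily W Y) \ Set.Icc W Y, c Z = c Finset.univ :=
      fun Z hZ => hm 0 Z hZ _ htop
    have hbelow : ∀ P, W < P → P < Y → ∀ Z, Z ≤ P → ¬ W ≤ Z → c Z = c ⊥ := fun P p1 p2 Z hZ hWZ =>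
      (hfst Z ⟨Or.inr (mem_downFamily.2 ⟨P, p1, p2, hZ⟩), fun h => hWZ h.1⟩).trans h01.symm
    have habove : ∀ P, W < P → P < Y → ∀ Z, P ≤ Z → ¬ Z ≤ Y → c Z = c ⊤ := fun P p1 p2 Z hZ hZY =>
      hfst Z ⟨Or.inl (mem_upFamily.2 ⟨P, p1, p2, hZ⟩), fun h => hZY h.2⟩
    refine ⟨fun Z z1 z2 => hm 2 Z ⟨z1, z2⟩ X ⟨hWX, hXY⟩, hbelow, habove, ?_, ?_⟩
    · intro Z hZY hWZ
      by_cases hZ : Z ∈ downFamily W Y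
      · obtain ⟨P, p1, p2, p3⟩ := mem_downFamily.1 hZ
        exact Or.inl (hbelow P p1 p2 Z p3 hWZ)
      by_cases hYZ : Z = Y
      · exact Or.inr (congrArg c hYZ)
      obtain ⟨T, hT | hT, hZT⟩ := hl Z ⟨⟨bot_le, hZY.lt_of_ne hYZ⟩, hZ⟩
      · exact Or.inl (hZT.trans ((hfst T hT).trans h01.symm))
      · exact Or.inr (hZT.trans (congrArg c hT))
    · intro Z hWZ hZY
      by_cases hZ : Z ∈ upFamily W Y
      · obtain ⟨P, p1, p2, p3⟩ := mem_upFamily.1 hZ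
        exact Or.inl (habove P p1 p2 Z p3 hZY)
      by_cases hZW : Z = W
      · exact Or.inr (congrArg c hZW)
      obtain ⟨T, hT | hT, hZT⟩ := hl' Z ⟨⟨hWZ.lt_of_ne' hZW, le_top⟩, hZ⟩
      · exact Or.inl (hZT.trans (hfst T hT))
      · exact Or.inr (hZT.trans (congrArg c hT))
  · intro W Y hWY hW hY hne
    have hch := (isRainbowChain_triple (c := c) hWY (hlt Y hY)).2 ⟨hne, hW, hY⟩
    by_cases hext : ∃ Z : B n, Z ∉ ({W, Y, Finset.univ} : Set (B n)) ∧
        IsRainbowChain c {Z, W, Y, Finset.univ}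
    · obtain ⟨Z, hZ⟩ := hext
      exact Or.inl ⟨Z, (isRainbowChain_extension hWY (hlt Y hY) ⟨hne, hW, hY⟩).1 hZ⟩
    · right
      intro Z hZ
      have hthree := h3 W Y hWY (hlt Y hY) hch hext
      by_contra! hcon
      have hsub : (({c Z, c W, c Y, c Finset.univ} : Finset (Fin k)) : Set (Fin k)) ⊆
          c '' (Set.Icc ∅ Y ∪ Set.Icc W Finset.univ) := by
        intro a ha
        simp only [Finset.coe_insert, Finset.coe_singleton, Set.mem_insert_iff,
          Set.mem_singleton_iff] at ha
        rcases ha with rfl | rfl | rfl | rfl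
        · exact ⟨Z, hZ.imp (fun h => ⟨bot_le, h⟩) fun h => ⟨h, le_top⟩, rfl⟩
        · exact ⟨W, Or.inr ⟨le_rfl, le_top⟩, rfl⟩
        · exact ⟨Y, Or.inl ⟨bot_le, le_rfl⟩, rfl⟩
        · exact ⟨Finset.univ, Or.inr ⟨le_top, le_rfl⟩, rfl⟩
      have hcard := Set.ncard_le_ncard hsub
      have hfour : ({c Z, c W, c Y, c Finset.univ} : Finset (Fin k)).card = 4 := by
        rw [Finset.card_insert_of_notMem, Finset.card_insert_of_notMem,
          Finset.card_insert_of_notMem, Finset.card_singleton] <;>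
          simp only [Finset.mem_insert, Finset.mem_singleton, not_or] <;> grind
      rw [Set.ncard_coe_finset, hthree, hfour] at hcard
      omega

end BooleanLattice

theorem theorem2p10 (n k : ℕ) (hk : 4 ≤ k) (hn : 4 < n)
    (c : BooleanLattice.B n → Fin k) (hc : BooleanLattice.IsExact c) :
    (¬ BooleanLattice.HasRainbowInducedCopy (BooleanLattice.B 2) c ↔
      (c ∅ ≠ c Finset.univ ∧
        (BooleanLattice.IsType1 c ∨ BooleanLattice.IsType2 c ∨
          BooleanLattice.IsType31 c ∨ BooleanLattice.IsType32 c ∨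
          BooleanLattice.IsType41 c ∨ BooleanLattice.IsType42 c)) ∨
      (c ∅ = c Finset.univ ∧ BooleanLattice.IsType5 c)) ∧
    (BooleanLattice.IsType1 c → k = 5) := by
  refine ⟨?_, fun h => h.eq_five hc⟩
  rw [BooleanLattice.not_hasRainbowInducedCopy_iff]
  constructor
  · intro h
    by_cases h01 : c ∅ = c Finset.univ
    · exact Or.inr ⟨h01, h.isType5 h01⟩
    refine Or.inl ⟨h01, ?_⟩
    have hcol : ∀ s : Finset (Fin k), s.card ≤ 3 → ∃ X, c X ∉ s := by
      intro s hs
      obtain ⟨a, -, ha⟩ := Finset.exists_mem_notMem_of_card_lt_card (s := s)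
        (t := Finset.univ) (by simpa using by omega)
      obtain ⟨X, rfl⟩ := hc a
      exact ⟨X, ha⟩
    obtain ⟨X, hX⟩ := hcol {c ∅, c Finset.univ} (Finset.card_le_two.trans (by norm_num))
    obtain ⟨Y, hY⟩ := hcol {c ∅, c Finset.univ, c X} Finset.card_le_three
    simp only [Finset.mem_insert, Finset.mem_singleton, not_or] at hX hY
    rcases h.classification h01 (X := X) (Y := Y) hX ⟨hY.1, hY.2.1⟩ (Ne.symm hY.2.2) with
      ⟨X, V, b, hb⟩ | ⟨X, W, b, hb⟩ | ⟨X, W, b, hb⟩ | ⟨X, b, hb⟩ | ⟨X, b, hb⟩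
    · exact hb.isType.imp id Or.inl
    · exact Or.inr (Or.inr (Or.inr (Or.inl hb.isType32)))
    · exact Or.inr (Or.inr (Or.inl hb.isType31))
    · exact Or.inr (Or.inr (Or.inr (Or.inr (Or.inl hb.isType41))))
    · exact Or.inr (Or.inr (Or.inr (Or.inr (Or.inr hb.isType42))))
  · rintro (⟨-, h | h | h | h | h | h⟩ | ⟨h01, h⟩)
    exacts [h.rainbowFree, h.rainbowFree, h.rainbowFree, h.rainbowFree, h.rainbowFree,
      h.rainbowFree, h.rainbowFree h01]
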